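/- Let $\varrho$ be an entangled state (a density matrix that is not a convex combination of product states) of $N$ qubits, held by observers $\mathcal O_1,\dots,\mathcal O_N$. Suppose that there are two distinct observers $a$ and $b$ each of whom can steer the remaining $N-1$ qubits into two different pure states by an orthogonal projective measurement on the own qubit; that is, for some orthonormal basis of that qubit, both outcomes of the measurement in this basis have positive probability, and they leave the other $N-1$ qubits in two pure states that differ from each other. Then: (1) $\varrho$ violates local realism: one can choose two orthogonal projective measurements for every observer in such a way that the resulting joint outcome probabilities $p(c_1,\dots,c_N\,|\,x_1,\dots,x_N)$, $x_i,c_i\in\{0,1\}$, admit no local hidden variable model $\int\prod_{i=1}^N P_i(c_i\,|\,x_i,\lambda)\,d\mu(\lambda)$ with $\mu$ a probability measure and $P_i(\cdot\,|\,x_i,\lambda)$ probability distributions. (2) $\varrho$ is either pure, or a rank-2 mixture $\varrho=\nu_1|\Psi_1\rangle\langle\Psi_1|+\nu_2|\Psi_2\rangle\langle\Psi_2|$ with $\nu_1,\nu_2>0$, $\nu_1+\nu_2=1$, and $$|\Psi_1\rangle=\cos\tfrac{\zeta}{2}\,|0_a0_b\rangle\otimes|\chi_1\rangle+\sin\tfrac{\zeta}{2}\,|1_a1_b\rangle\otimes|\chi_2\rangle,\qquad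 |\Psi_2\rangle=\sin\tfrac{\zeta}{2}\,|0_a0_b\rangle\otimes|\chi_1\rangle-\cos\tfrac{\zeta}{2}\,|1_a1_b\rangle\otimes|\chi_2\rangle,$$ for some real $\zeta$, some orthonormal bases $|0_a\rangle,|1_a\rangle$ and $|0_b\rangle,|1_b\rangle$ of the qubits $a$ and $b$, and some unit vectors $|\chi_1\rangle,|\chi_2\rangle$ of the other $N-2$ qubits. -/

import Mathlib

open scoped ComplexConjugate ComplexOrder

noncomputable section

namespace NQubit

/-- The state space `ℂ²` of one qubit. -/
abbrev Qubit := EuclideanSpace ℂ (Fin 2)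

/-- An orthogonal projective (von Neumann) measurement on one qubit, with outcomes `0` and `1`:
outcome `c` of `M` is the projection onto the line of `M c`. -/
abbrev QubitMeasurement := OrthonormalBasis (Fin 2) ℂ Qubit

/-- State vectors of a family of qubits indexed by `ι`, written in the computational basis. -/
abbrev Ket (ι : Type*) := EuclideanSpace ℂ (ι → Fin 2)

/-- Operators on the Hilbert space of a family of qubits indexed by `ι`. -/
abbrev Operator (ι : Type*) := Matrix (ι → Fin 2) (ι → Fin 2) ℂ

section

variable {ι : Type*} [Fintype ι] [DecidableEq ι]

/-- Density matrices. -/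
def IsState (ρ : Operator ι) : Prop :=
  ρ.PosSemidef ∧ ρ.trace = 1

/-- The operator `|ψ⟩⟨ψ|`. -/
def ketbra (ψ : Ket ι) : Operator ι :=
  Matrix.of fun s t => ψ s * conj (ψ t)

/-- The product vector `⊗ᵢ |vᵢ⟩`. -/
def tensorKet (v : ι → Qubit) : Ket ι :=
  WithLp.toLp 2 fun s => ∏ i, v i (s i)

/-- The state `ρ` is pure. -/
def IsPure (ρ : Operator ι) : Prop :=
  ∃ ψ : Ket ι, ‖ψ‖ = 1 ∧ ρ = ketbra ψ

/-- The state `ρ` is (fully) separable: a finite convex combination of pure product states. -/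
def IsSeparable (ρ : Operator ι) : Prop :=
  ρ ∈ convexHull ℝ
    {σ : Operator ι | ∃ v : ι → Qubit, (∀ i, ‖v i‖ = 1) ∧ σ = ketbra (tensorKet v)}

/-- The state `ρ` is entangled. -/
def IsEntangled (ρ : Operator ι) : Prop :=
  ¬ IsSeparable ρ

/-! ### Steering -/

/-- The computational basis label that is `c` at qubit `k` and `s` at the other qubits. -/
def glue (k : ι) (c : Fin 2) (s : {j : ι // j ≠ k} → Fin 2) : ι → Fin 2 :=
  fun j => if h : j = k then c else s ⟨j, h⟩

/-- The operator `⟨v|ρ|v⟩` on the qubits other than `k`, where `v` is a vector of qubit `k`: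
the unnormalized state of the other qubits after qubit `k` is found in the state `v`. -/
def collapse (ρ : Operator ι) (k : ι) (v : Qubit) : Operator {j : ι // j ≠ k} :=
  Matrix.of fun s t => ∑ c, ∑ d, conj (v c) * ρ (glue k c s) (glue k d t) * v d

/-- The probability (as a complex number) that a measurement of qubit `k` finds it in the
state `v`. -/
def outcomeProb (ρ : Operator ι) (k : ι) (v : Qubit) : ℂ :=
  (collapse ρ k v).trace

/-- The normalized state of the qubits other than `k` after qubit `k` is found in the
state `v`; meaningful when `outcomeProb ρ k v ≠ 0`. -/
def steeredState (ρ : Operator ι) (k : ι) (v : Qubit) : Operator {j : ι // j ≠ k} :=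
  (outcomeProb ρ k v)⁻¹ • collapse ρ k v

/-- Observer `k` can steer the other qubits into two different pure states: for some orthogonal
projective measurement on qubit `k`, both outcomes occur, and they leave the other qubits in pure
states that differ from each other. -/
def CanSteer (ρ : Operator ι) (k : ι) : Prop :=
  ∃ M : QubitMeasurement,
    (∀ c : Fin 2, outcomeProb ρ k (M c) ≠ 0 ∧ IsPure (steeredState ρ k (M c))) ∧
    steeredState ρ k (M 0) ≠ steeredState ρ k (M 1)

/-! ### Local realism -/

/-- The probability that the measurements `M i` on the qubits `i` have the outcomes `c i`, that
is `⟨w|ρ|w⟩` with `w = ⊗ᵢ |M i (c i)⟩`. -/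
def jointProb (ρ : Operator ι) (M : ι → QubitMeasurement) (c : ι → Fin 2) : ℝ :=
  (∑ s, ∑ t, conj (tensorKet (fun i => M i (c i)) s) * ρ s t *
    tensorKet (fun i => M i (c i)) t).re

/-- Local hidden variable model for the statistics of `ρ` when observer `i` may choose among the
measurements `M i x`, `x : X`: a hidden variable `l` with a probability distribution `μ` that does
not depend on the choices, and for every observer `i`, choice `x` and value `l` a probability
distribution `P i x l` of the outcome. -/
def HasLocalModel {X : Type*} (ρ : Operator ι) (M : ι → X → QubitMeasurement) : Prop :=
  ∃ (L : Type) (_ : MeasurableSpace L) (μ : MeasureTheory.Measure L)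
    (P : ι → X → L → Fin 2 → ℝ),
    MeasureTheory.IsProbabilityMeasure μ ∧
    (∀ i x c, Measurable fun l => P i x l c) ∧
    (∀ i x l c, 0 ≤ P i x l c) ∧
    (∀ i x l, ∑ c, P i x l c = 1) ∧
    ∀ (x : ι → X) (c : ι → Fin 2),
      jointProb ρ (fun i => M i (x i)) c = ∫ l, ∏ i, P i (x i) l (c i) ∂μ

/-- The state `ρ` violates local realism: every observer can be given two orthogonal projective
measurements such that the resulting joint statistics have no local hidden variable model.
(So there is no such model for larger families of measurements either.) -/
def ViolatesLocalRealism (ρ : Operator ι) : Prop :=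
  ∃ M : ι → Fin 2 → QubitMeasurement, ¬ HasLocalModel ρ M

/-! ### The mixtures of GHZ-like states -/

/-- The vector `|u⟩_a |v⟩_b ⊗ |χ⟩`, with `χ` a vector of the qubits other than `a` and `b`. -/
def pairKet (a b : ι) (u v : Qubit) (χ : Ket {j : ι // j ≠ a ∧ j ≠ b}) : Ket ι :=
  WithLp.toLp 2 fun s => u (s a) * v (s b) * χ (fun j => s j)

/-- The state `ρ` is a mixture, with positive weights `ν₁` and `ν₂`, of the two orthonormal
vectors
`cos (ζ/2) |0_a 0_b⟩ |χ₁⟩ + sin (ζ/2) |1_a 1_b⟩ |χ₂⟩` and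
`sin (ζ/2) |0_a 0_b⟩ |χ₁⟩ - cos (ζ/2) |1_a 1_b⟩ |χ₂⟩`,
where `|0⟩, |1⟩` are suitable orthonormal bases `A` and `B` of the qubits `a` and `b`.
(A relative phase is part of `χ₂`.) -/
def IsGHZLikeMixture (ρ : Operator ι) (a b : ι) : Prop :=
  ∃ (A B : QubitMeasurement) (χ₁ χ₂ : Ket {j : ι // j ≠ a ∧ j ≠ b}) (ζ ν₁ ν₂ : ℝ),
    ‖χ₁‖ = 1 ∧ ‖χ₂‖ = 1 ∧ 0 < ν₁ ∧ 0 < ν₂ ∧ ν₁ + ν₂ = 1 ∧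
    ρ = (ν₁ : ℂ) • ketbra
          ((Real.cos (ζ / 2) : ℂ) • pairKet a b (A 0) (B 0) χ₁ +
            (Real.sin (ζ / 2) : ℂ) • pairKet a b (A 1) (B 1) χ₂) +
        (ν₂ : ℂ) • ketbra
          ((Real.sin (ζ / 2) : ℂ) • pairKet a b (A 0) (B 0) χ₁ -
            (Real.cos (ζ / 2) : ℂ) • pairKet a b (A 1) (B 1) χ₂)

end

end NQubit

end

open scoped ComplexConjugate ComplexOrder

noncomputable section

namespace NQubit

/-! ### Measurements on one qubit -/

lemma exists_measurement {u v : Qubit} (hu : ‖u‖ = 1) (hv : ‖v‖ = 1) (huv : inner ℂ u v = 0) :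
    ∃ M : QubitMeasurement, M 0 = u ∧ M 1 = v := by
  have ho : Orthonormal ℂ ![u, v] := by
    rw [orthonormal_iff_ite]
    have hvu : inner ℂ v u = 0 := inner_eq_zero_symm.mp huv
    intro i j
    fin_cases i <;> fin_cases j <;>
      simp [huv, hvu, inner_self_eq_norm_sq_to_K, hu, hv]
  have hs : ⊤ ≤ Submodule.span ℂ (Set.range ![u, v]) := by
    rw [ho.linearIndependent.span_eq_top_of_card_eq_finrank' (by simp)]
  exact ⟨OrthonormalBasis.mk ho hs, by simp, by simp⟩

lemma exists_measurement_zero {u : Qubit} (hu : ‖u‖ = 1) :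
    ∃ M : QubitMeasurement, M 0 = u := by
  have hn : ‖(WithLp.toLp 2 ![-conj (u 1), conj (u 0)] : Qubit)‖ = ‖u‖ := by
    simp [EuclideanSpace.norm_eq, Fin.sum_univ_two, add_comm]
  obtain ⟨M, h, -⟩ := exists_measurement (u := u)
    (v := WithLp.toLp 2 ![-conj (u 1), conj (u 0)]) hu (hn.trans hu)
    (by simp [PiLp.inner_apply, Fin.sum_univ_two]; ring)
  exact ⟨M, h⟩

lemma exists_rotation (A : QubitMeasurement) {c s : ℝ} (h : c ^ 2 + s ^ 2 = 1) :
    ∃ M : QubitMeasurement, M 0 = (c : ℂ) • A 0 + (s : ℂ) • A 1 ∧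
      M 1 = (-s : ℂ) • A 0 + (c : ℂ) • A 1 := by
  have hA := orthonormal_iff_ite.mp A.orthonormal
  have hc : (c : ℂ) ^ 2 + (s : ℂ) ^ 2 = 1 := by exact_mod_cast h
  have key : ∀ x y x' y' : ℂ, inner ℂ (x • A 0 + y • A 1) (x' • A 0 + y' • A 1) =
      conj x * x' + conj y * y' := by
    intro x y x' y'
    simp only [inner_add_left, inner_add_right, inner_smul_left, inner_smul_right, hA]
    simp
    ring
  have hn : ∀ x y : ℂ, conj x * x + conj y * y = 1 → ‖x • A 0 + y • A 1‖ = 1 := by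
    intro x y hxy
    have := inner_self_eq_norm_sq_to_K (𝕜 := ℂ) (x • A 0 + y • A 1)
    rw [key, hxy] at this
    have h2 : ‖x • A 0 + y • A 1‖ ^ 2 = 1 := by
      rw [eq_comm, ← Complex.ofReal_inj]
      simpa using this
    exact (pow_eq_one_iff_of_nonneg (norm_nonneg _) two_ne_zero).mp h2
  refine exists_measurement (hn _ _ ?_) (hn _ _ ?_) ?_
  · simp only [Complex.conj_ofReal]; linear_combination hc
  · simp only [map_neg, Complex.conj_ofReal]; linear_combination hc
  · rw [key]; simp only [Complex.conj_ofReal]; ring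

lemma exists_phase (A : QubitMeasurement) {z : ℂ} (hz : ‖z‖ = 1) :
    ∃ M : QubitMeasurement, M 0 = A 0 ∧ M 1 = z • A 1 := by
  have hA := orthonormal_iff_ite.mp A.orthonormal
  exact exists_measurement (A.orthonormal.1 0) (by rw [norm_smul, hz, A.orthonormal.1 1, one_mul])
    (by simp [hA])

/-! ### The inequality of Clauser, Horne, Shimony and Holt -/

lemma chsh_pointwise {a a' b b' : ℝ} (ha : |a| ≤ 1) (ha' : |a'| ≤ 1) (hb : |b| ≤ 1)
    (hb' : |b'| ≤ 1) : a * (b + b') + a' * (b - b') ≤ 2 := by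
  rw [abs_le] at *
  rcases le_total 0 (b + b') with h | h <;> rcases le_total 0 (b - b') with h' | h' <;> nlinarith

lemma chsh_le {L : Type*} [MeasurableSpace L] (μ : MeasureTheory.Measure L)
    [MeasureTheory.IsProbabilityMeasure μ] (p q : Fin 2 → L → Fin 2 → ℝ) (g : L → ℝ)
    (hpm : ∀ x c, Measurable fun l => p x l c) (hqm : ∀ x c, Measurable fun l => q x l c)
    (hgm : Measurable g) (hp : ∀ x l c, 0 ≤ p x l c) (hq : ∀ x l c, 0 ≤ q x l c)
    (hps : ∀ x l, ∑ c, p x l c = 1) (hqs : ∀ x l, ∑ c, q x l c = 1)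
    (hg : ∀ l, 0 ≤ g l) (hg' : ∀ l, g l ≤ 1) (J : Fin 2 → Fin 2 → Fin 2 → Fin 2 → ℝ)
    (hJ : ∀ x y c d, J x y c d = ∫ l, p x l c * q y l d * g l ∂μ)
    (E : Fin 2 → Fin 2 → ℝ)
    (hE : ∀ x y, E x y = J x y 0 0 - J x y 0 1 - J x y 1 0 + J x y 1 1) :
    E 0 0 + E 0 1 + E 1 0 - E 1 1 ≤ 2 * (J 0 0 0 0 + J 0 0 0 1 + J 0 0 1 0 + J 0 0 1 1) := by
  have le_one : ∀ (r : Fin 2 → Fin 2 → ℝ), (∀ x c, 0 ≤ r x c) → (∀ x, ∑ c, r x c = 1) →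
      ∀ x c, r x c ≤ 1 := fun r h0 h1 x c =>
    (h1 x) ▸ Finset.single_le_sum (f := r x) (fun i _ => h0 x i) (Finset.mem_univ c)
  have hp1 : ∀ x l c, p x l c ≤ 1 := fun x l c =>
    le_one (fun x c => p x l c) (fun x c => hp x l c) (fun x => hps x l) x c
  have hq1 : ∀ x l c, q x l c ≤ 1 := fun x l c =>
    le_one (fun x c => q x l c) (fun x c => hq x l c) (fun x => hqs x l) x c
  have hint : ∀ x y c d, MeasureTheory.Integrable (fun l => p x l c * q y l d * g l) μ := by
    intro x y c d
    refine MeasureTheory.Integrable.of_bound (C := 1)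
      (((hpm x c).mul (hqm y d)).mul hgm).aestronglyMeasurable (Filter.Eventually.of_forall ?_)
    intro l
    rw [Real.norm_of_nonneg (mul_nonneg (mul_nonneg (hp _ _ _) (hq _ _ _)) (hg _))]
    exact mul_le_one₀ (mul_le_one₀ (hp1 _ _ _) (hq _ _ _) (hq1 _ _ _)) (hg _) (hg' _)
  have hlin : ∀ κ : Fin 2 → Fin 2 → Fin 2 → Fin 2 → ℝ,
      ∑ x, ∑ y, ∑ c, ∑ d, κ x y c d * J x y c d =
        ∫ l, ∑ x, ∑ y, ∑ c, ∑ d, κ x y c d * (p x l c * q y l d * g l) ∂μ := by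
    intro κ
    rw [MeasureTheory.integral_finsetSum _ fun x _ => MeasureTheory.integrable_finsetSum _
      fun y _ => MeasureTheory.integrable_finsetSum _ fun c _ =>
        MeasureTheory.integrable_finsetSum _ fun d _ => (hint x y c d).const_mul _]
    refine Finset.sum_congr rfl fun x _ => ?_
    rw [MeasureTheory.integral_finsetSum _ fun y _ => MeasureTheory.integrable_finsetSum _
      fun c _ => MeasureTheory.integrable_finsetSum _ fun d _ => (hint x y c d).const_mul _]
    refine Finset.sum_congr rfl fun y _ => ?_
    rw [MeasureTheory.integral_finsetSum _ fun c _ => MeasureTheory.integrable_finsetSum _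
      fun d _ => (hint x y c d).const_mul _]
    refine Finset.sum_congr rfl fun c _ => ?_
    rw [MeasureTheory.integral_finsetSum _ fun d _ => (hint x y c d).const_mul _]
    refine Finset.sum_congr rfl fun d _ => ?_
    rw [MeasureTheory.integral_const_mul, hJ]
  have hpos : 0 ≤ ∫ l, ∑ x, ∑ y, ∑ c, ∑ d,
      (![![![![1, 3], ![3, 1]], ![![-1, 1], ![1, -1]]],
        ![![![-1, 1], ![1, -1]], ![![1, -1], ![-1, 1]]]] x y c d : ℝ) *
        (p x l c * q y l d * g l) ∂μ := by
    refine MeasureTheory.integral_nonneg fun l => ?_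
    have h : ∀ r : Fin 2 → L → Fin 2 → ℝ, (∀ x l c, 0 ≤ r x l c) →
        (∀ x l, ∑ c, r x l c = 1) → ∀ x, r x l 1 = 1 - r x l 0 ∧ |2 * r x l 0 - 1| ≤ 1 := by
      intro r h0 h1 x
      have h2 := h1 x l
      have h3 := h0 x l 0
      have h4 := h0 x l 1
      rw [Fin.sum_univ_two] at h2
      exact ⟨by linarith, abs_le.mpr ⟨by linarith, by linarith⟩⟩
    have h1 := chsh_pointwise (h p hp hps 0).2 (h p hp hps 1).2 (h q hq hqs 0).2 (h q hq hqs 1).2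
    simp only [Fin.sum_univ_two, (h p hp hps _).1, (h q hq hqs _).1]
    simp
    nlinarith [mul_le_mul_of_nonneg_right h1 (hg l)]
  rw [← hlin] at hpos
  simp only [Fin.sum_univ_two, hE] at *
  simp at hpos
  linarith

/-! ### Overlaps with product vectors -/

section

variable {ι : Type*} [Fintype ι] [DecidableEq ι]

/-- The multilinear form `v ↦ ⟨ψ|⊗ᵢ vᵢ⟩`. -/
def overlap (ψ : Ket ι) : MultilinearMap ℂ (fun _ : ι => Qubit) ℂ :=
  ∑ t, conj (ψ t) • (MultilinearMap.mkPiAlgebra ℂ ι ℂ).compLinearMap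
    fun i => (EuclideanSpace.proj (𝕜 := ℂ) (t i)).toLinearMap

lemma overlap_apply (ψ : Ket ι) (v : ι → Qubit) :
    overlap ψ v = ∑ t, conj (ψ t) * ∏ i, v i (t i) := by
  simp [overlap]

lemma overlap_single (ψ : Ket ι) (s : ι → Fin 2) :
    overlap ψ (fun i => EuclideanSpace.single (s i) 1) = conj (ψ s) := by
  rw [overlap_apply, Finset.sum_eq_single s]
  · simp
  · intro t _ hts
    obtain ⟨i, hi⟩ := Function.ne_iff.mp hts
    rw [Finset.prod_eq_zero (Finset.mem_univ i), mul_zero]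
    simp [hi]
  · simp

/-- The vectors `Ψ k` decompose the operator `ρ` as `∑ₖ |Ψ k⟩⟨Ψ k|`. -/
def Decomposes {K : Type*} [Fintype K] (ρ : Operator ι) (Ψ : K → Ket ι) : Prop :=
  ρ = ∑ k, ketbra (Ψ k)

omit [Fintype ι] [DecidableEq ι] in
lemma Decomposes.apply {K : Type*} [Fintype K] {ρ : Operator ι} {Ψ : K → Ket ι}
    (h : Decomposes ρ Ψ) (s t : ι → Fin 2) : ρ s t = ∑ k, Ψ k s * conj (Ψ k t) := by
  rw [h]
  simp [Matrix.sum_apply, ketbra]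

omit [DecidableEq ι] in
lemma exists_decomposition {ρ : Operator ι} (hρ : ρ.PosSemidef) :
    ∃ (m : ℕ) (Ψ : Fin m → Ket ι), Decomposes ρ Ψ := by
  obtain ⟨m, v, hv⟩ := Matrix.posSemidef_iff_eq_sum_vecMulVec.mp hρ
  refine ⟨m, fun k => WithLp.toLp 2 (v k), ?_⟩
  ext s t
  simp [hv, Matrix.sum_apply, ketbra, Matrix.vecMulVec_apply]

lemma Decomposes.jointProb {K : Type*} [Fintype K] {ρ : Operator ι} {Ψ : K → Ket ι}
    (h : Decomposes ρ Ψ) (M : ι → QubitMeasurement) (c : ι → Fin 2) :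
    jointProb ρ M c = ∑ k, Complex.normSq (overlap (Ψ k) fun i => M i (c i)) := by
  have : ∑ s, ∑ t, conj (tensorKet (fun i => M i (c i)) s) * ρ s t *
      tensorKet (fun i => M i (c i)) t =
      ∑ k, (Complex.normSq (overlap (Ψ k) fun i => M i (c i)) : ℂ) := by
    simp only [h.apply, ← Complex.mul_conj, overlap_apply, map_sum, map_mul, Complex.conj_conj,
      tensorKet, Finset.mul_sum, Finset.sum_mul]
    conv_rhs => rw [Finset.sum_comm]
    refine Finset.sum_congr rfl fun t _ => ?_
    conv_rhs => rw [Finset.sum_comm]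
    refine Finset.sum_congr rfl fun s _ => Finset.sum_congr rfl fun k _ => ?_
    ring
  rw [NQubit.jointProb, this]
  simp

/-! ### Violation of local realism by a correlated pair of qubits -/

omit [Fintype ι] in
lemma update_pair_apply {β : Type*} {a b : ι} (hab : a ≠ b) (w : ι → β) (u v : β) (i : ι) :
    Function.update (Function.update w a u) b v i = if i = a then u else if i = b then v else w i := by
  by_cases hb : i = b
  · subst hb; simp [hab.symm]
  · by_cases ha : i = a
    · subst ha; simp [hab]
    · simp [ha, hb]

lemma prod_pair_mul {R : Type*} [CommMonoid R] {a b : ι} (hab : a ≠ b) (f : ι → R) :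
    ∏ i, f i = f a * f b * ∏ i ∈ (Finset.univ.erase a).erase b, f i := by
  rw [← Finset.mul_prod_erase Finset.univ f (Finset.mem_univ a),
    ← Finset.mul_prod_erase (Finset.univ.erase a) f
      (Finset.mem_erase.mpr ⟨hab.symm, Finset.mem_univ b⟩), mul_assoc]

/-- If `J x y c d` are the joint probabilities of two observers, when all the other observers make
a fixed measurement with a fixed outcome, then a local model implies the CHSH inequality. -/
lemma HasLocalModel.chsh {ρ : Operator ι} {M : ι → Fin 2 → QubitMeasurement}
    (h : HasLocalModel ρ M) {a b : ι} (hab : a ≠ b) (J : Fin 2 → Fin 2 → Fin 2 → Fin 2 → ℝ)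
    (hJ : ∀ x y c d, J x y c d =
      jointProb ρ (fun i => M i (Function.update (Function.update (0 : ι → Fin 2) a x) b y i))
        (Function.update (Function.update (0 : ι → Fin 2) a c) b d))
    (E : Fin 2 → Fin 2 → ℝ)
    (hE : ∀ x y, E x y = J x y 0 0 - J x y 0 1 - J x y 1 0 + J x y 1 1) :
    E 0 0 + E 0 1 + E 1 0 - E 1 1 ≤ 2 * (J 0 0 0 0 + J 0 0 0 1 + J 0 0 1 0 + J 0 0 1 1) := by
  obtain ⟨L, _, μ, P, hμ, hm, hpos, hsum, hprob⟩ := h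
  refine chsh_le μ (P a) (P b) (fun l => ∏ i ∈ (Finset.univ.erase a).erase b, P i 0 l 0)
    (hm a) (hm b) (Finset.measurable_prod _ fun i _ => hm i 0 0) (hpos a) (hpos b)
    (hsum a) (hsum b) (fun l => Finset.prod_nonneg fun i _ => hpos _ _ _ _)
    (fun l => Finset.prod_le_one (fun i _ => hpos _ _ _ _) fun i _ => ?_) J ?_ E hE
  · exact (hsum i 0 l) ▸ Finset.single_le_sum (f := P i 0 l) (fun c _ => hpos _ _ _ c)
      (Finset.mem_univ 0)
  · intro x y c d
    rw [hJ, hprob]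
    congr 1
    funext l
    rw [prod_pair_mul hab]
    simp only [update_pair_apply hab, if_true, if_neg hab.symm]
    congr 1
    refine Finset.prod_congr rfl fun i hi => ?_
    simp only [Finset.mem_erase] at hi
    simp [hi.1, hi.2.1]

lemma overlap_pair_combination (ψ : Ket ι) {a b : ι} (hab : a ≠ b) (w : ι → Qubit)
    (A B : Fin 2 → Qubit) (α β γ δ : ℂ)
    (h01 : overlap ψ (Function.update (Function.update w a (A 0)) b (B 1)) = 0)
    (h10 : overlap ψ (Function.update (Function.update w a (A 1)) b (B 0)) = 0) :
    overlap ψ (Function.update (Function.update w a (α • A 0 + β • A 1)) b (γ • B 0 + δ • B 1)) =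
      α * γ * overlap ψ (Function.update (Function.update w a (A 0)) b (B 0)) +
      β * δ * overlap ψ (Function.update (Function.update w a (A 1)) b (B 1)) := by
  rw [MultilinearMap.map_update_add, MultilinearMap.map_update_smul,
    MultilinearMap.map_update_smul]
  simp only [Function.update_comm hab]
  simp only [Function.update_comm hab] at h01 h10
  simp only [MultilinearMap.map_update_add, MultilinearMap.map_update_smul, h01, h10, smul_eq_mul]
  ring

lemma exists_chsh_angle {n y : ℝ} (hn : 0 < n) (hy : 0 < y) :
    ∃ c s : ℝ, c ^ 2 + s ^ 2 = 1 ∧ 2 * n < 2 * ((c ^ 2 - s ^ 2) * n + 4 * c * s * y) := by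
  obtain ⟨t, ht0, hyt⟩ : ∃ t : ℝ, 0 < t ∧ y = t * n := ⟨y / n, div_pos hy hn, by field_simp⟩
  have h1 : 0 < 1 + t ^ 2 := by positivity
  have hs : Real.sqrt (1 + t ^ 2) ^ 2 = 1 + t ^ 2 := Real.sq_sqrt h1.le
  refine ⟨1 / Real.sqrt (1 + t ^ 2), t / Real.sqrt (1 + t ^ 2), ?_, ?_⟩
  · rw [div_pow, div_pow, hs]; field_simp
  · have h2 : 4 * (1 / Real.sqrt (1 + t ^ 2)) * (t / Real.sqrt (1 + t ^ 2)) = 4 * t / (1 + t ^ 2) := by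
      rw [mul_assoc, div_mul_div_comm, one_mul, ← sq, hs]; ring
    rw [h2, div_pow, div_pow, hs, hyt]
    have h3 : (1 ^ 2 / (1 + t ^ 2) - t ^ 2 / (1 + t ^ 2)) * n + 4 * t / (1 + t ^ 2) * (t * n) =
        n + n * (2 * t ^ 2 / (1 + t ^ 2)) := by
      field_simp; ring
    rw [h3]
    have : 0 < n * (2 * t ^ 2 / (1 + t ^ 2)) := by positivity
    linarith

/-- The version of `violates_of_correlated` in which the other qubits are projected onto unit
vectors and the coherence is a positive number. -/
lemma violates_of_correlated_normalized {K : Type*} [Fintype K] {ρ : Operator ι} {Ψ : K → Ket ι}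
    (hρ : Decomposes ρ Ψ) {a b : ι} (hab : a ≠ b) (w : ι → Qubit)
    (hw : ∀ i, i ≠ a → i ≠ b → ‖w i‖ = 1) (A B : QubitMeasurement)
    (h01 : ∀ k, overlap (Ψ k) (Function.update (Function.update w a (A 0)) b (B 1)) = 0)
    (h10 : ∀ k, overlap (Ψ k) (Function.update (Function.update w a (A 1)) b (B 0)) = 0)
    {y : ℝ} (hy : 0 < y)
    (h : ∑ k, conj (overlap (Ψ k) (Function.update (Function.update w a (A 0)) b (B 0))) *
      overlap (Ψ k) (Function.update (Function.update w a (A 1)) b (B 1)) = y) :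
    ViolatesLocalRealism ρ := by
  set p := ∑ k, Complex.normSq
    (overlap (Ψ k) (Function.update (Function.update w a (A 0)) b (B 0))) with hp
  set q := ∑ k, Complex.normSq
    (overlap (Ψ k) (Function.update (Function.update w a (A 1)) b (B 1))) with hq
  have hp0 : 0 ≤ p := Finset.sum_nonneg fun k _ => Complex.normSq_nonneg _
  have hq0 : 0 ≤ q := Finset.sum_nonneg fun k _ => Complex.normSq_nonneg _
  have hsum : ∀ α β γ δ : ℝ, ∑ k, Complex.normSq (overlap (Ψ k) (Function.update
      (Function.update w a ((α : ℂ) • A 0 + (β : ℂ) • A 1)) b ((γ : ℂ) • B 0 + (δ : ℂ) • B 1))) =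
      α ^ 2 * γ ^ 2 * p + β ^ 2 * δ ^ 2 * q + 2 * (α * γ * β * δ) * y := by
    intro α β γ δ
    have hy' := congrArg Complex.re h
    rw [Complex.re_sum, Complex.ofReal_re] at hy'
    rw [← hy', hp, hq, Finset.mul_sum, Finset.mul_sum, Finset.mul_sum, ← Finset.sum_add_distrib,
      ← Finset.sum_add_distrib]
    refine Finset.sum_congr rfl fun k _ => ?_
    rw [overlap_pair_combination (Ψ k) hab w A B _ _ _ _ (h01 k) (h10 k)]
    simp [Complex.normSq_apply]
    ring
  have hn : 0 < p + q := by
    by_contra hcon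
    have hp1 : p = 0 := by linarith
    rw [hp, Finset.sum_eq_zero_iff_of_nonneg fun k _ => Complex.normSq_nonneg _] at hp1
    rw [Finset.sum_eq_zero fun k hk => by rw [Complex.normSq_eq_zero.mp (hp1 k hk)]; simp] at h
    exact hy.ne (by exact_mod_cast h)
  obtain ⟨c, s, hcs, hviol⟩ := exists_chsh_angle hn hy
  obtain ⟨A', hA0, hA1⟩ := exists_rotation A
    (c := 1 / Real.sqrt 2) (s := 1 / Real.sqrt 2) (by simp; norm_num)
  obtain ⟨B', hB0, hB1⟩ := exists_rotation B hcs
  obtain ⟨B'', hB0', hB1'⟩ := exists_rotation B (c := c) (s := -s) (by simpa using hcs)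
  have hW : ∀ i, ∃ M : QubitMeasurement, i ≠ a → i ≠ b → M 0 = w i := by
    intro i
    by_cases hi : i ≠ a ∧ i ≠ b
    · obtain ⟨M, hM⟩ := exists_measurement_zero (hw i hi.1 hi.2)
      exact ⟨M, fun _ _ => hM⟩
    · exact ⟨A, fun h1 h2 => absurd ⟨h1, h2⟩ hi⟩
  choose W hW using hW
  refine ⟨fun i x => if i = a then ![A, A'] x else if i = b then ![B', B''] x else W i, ?_⟩
  intro hlocal
  have hJ : ∀ x y c d : Fin 2,
      (fun i => (if i = a then ![A, A'] (Function.update (Function.update (0 : ι → Fin 2) a x) b y i)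
        else if i = b then ![B', B''] (Function.update (Function.update (0 : ι → Fin 2) a x) b y i) else W i)
        (Function.update (Function.update (0 : ι → Fin 2) a c) b d i)) =
      Function.update (Function.update w a (![A, A'] x c)) b (![B', B''] y d) := by
    intro x y c d
    funext i
    simp only [update_pair_apply hab]
    by_cases ha : i = a
    · simp [ha]
    · by_cases hb : i = b
      · simp [hb, hab.symm]
      · simp [ha, hb, hW i ha hb]
  set r := 1 / Real.sqrt 2 with hr
  have hr2 : r ^ 2 = 1 / 2 := by rw [hr, div_pow, Real.sq_sqrt zero_le_two, one_pow]
  have hA : ∀ x d, ![A, A'] x d = ((![![1, 0], ![r, -r]] x d : ℝ) : ℂ) • A 0 +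
      ((![![0, 1], ![r, r]] x d : ℝ) : ℂ) • A 1 := by
    intro x d
    fin_cases x <;> fin_cases d <;> simp [hA0, hA1]
  have hB : ∀ x d, ![B', B''] x d = ((![![c, -s], ![c, s]] x d : ℝ) : ℂ) • B 0 +
      ((![![s, c], ![-s, c]] x d : ℝ) : ℂ) • B 1 := by
    intro x d
    fin_cases x <;> fin_cases d <;> simp [hB0, hB1, hB0', hB1']
  have key := HasLocalModel.chsh hlocal hab _ (fun _ _ _ _ => rfl) _ (fun _ _ => rfl)
  simp only [hρ.jointProb, hJ, hA, hB, hsum] at key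
  simp at key
  simp only [hr2] at key
  ring_nf at key hviol
  simp only [hr2] at key
  nlinarith

theorem violates_of_correlated {K : Type*} [Fintype K] {ρ : Operator ι} {Ψ : K → Ket ι}
    (hρ : Decomposes ρ Ψ) {a b : ι} (hab : a ≠ b) (w : ι → Qubit) (A B : QubitMeasurement)
    (h01 : ∀ k, overlap (Ψ k) (Function.update (Function.update w a (A 0)) b (B 1)) = 0)
    (h10 : ∀ k, overlap (Ψ k) (Function.update (Function.update w a (A 1)) b (B 0)) = 0)
    (h : ∑ k, conj (overlap (Ψ k) (Function.update (Function.update w a (A 0)) b (B 0))) *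
      overlap (Ψ k) (Function.update (Function.update w a (A 1)) b (B 1)) ≠ 0) :
    ViolatesLocalRealism ρ := by
  have hw : ∀ i, i ≠ a → i ≠ b → w i ≠ 0 := by
    intro i ha hb hi
    refine h (Finset.sum_eq_zero fun k _ => ?_)
    rw [(overlap (Ψ k)).map_coord_zero (m := Function.update (Function.update w a (A 1)) b (B 1)) i
      (by simp [ha, hb, hi]), mul_zero]
  set r : ι → ℂ := fun i => if i = a then 1 else if i = b then 1 else (‖w i‖⁻¹ : ℝ) with hr
  have hscale : ∀ k u v, overlap (Ψ k)
      (Function.update (Function.update (fun i => r i • w i) a u) b v) =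
      (∏ i, r i) * overlap (Ψ k) (Function.update (Function.update w a u) b v) := by
    intro k u v
    rw [← smul_eq_mul, ← MultilinearMap.map_smul_univ]
    congr 1
    funext i
    simp only [update_pair_apply hab, hr]
    split_ifs <;> simp
  have hr0 : ∏ i, r i ≠ 0 := by
    refine Finset.prod_ne_zero_iff.mpr fun i _ => ?_
    simp only [hr]
    split_ifs with ha hb
    · simp
    · simp
    · simpa using hw i ha hb
  set R := ∏ i, r i with hR
  set S := ∑ k, conj (overlap (Ψ k) (Function.update (Function.update w a (A 0)) b (B 0))) *
      overlap (Ψ k) (Function.update (Function.update w a (A 1)) b (B 1)) with hS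
  obtain ⟨A', hA0, hA1⟩ := exists_phase A (z := conj S / ‖S‖) (by
    rw [norm_div, RCLike.norm_conj, Complex.norm_real, norm_norm, div_self (norm_ne_zero_iff.mpr h)])
  have hA1' : ∀ k v, overlap (Ψ k) (Function.update (Function.update (fun i => r i • w i) a (A' 1)) b v)
      = conj S / ‖S‖ * (R * overlap (Ψ k) (Function.update (Function.update w a (A 1)) b v)) := by
    intro k v
    rw [hscale, hA1, Function.update_comm hab, MultilinearMap.map_update_smul,
      Function.update_comm hab.symm, smul_eq_mul]
    ring
  refine violates_of_correlated_normalized hρ hab (fun i => r i • w i) ?_ A' B ?_ ?_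
    (y := Complex.normSq R * ‖S‖) (by
      have := Complex.normSq_pos.mpr hr0
      have := norm_pos_iff.mpr h
      positivity) ?_
  · intro i ha hb
    simp only [hr, if_neg ha, if_neg hb, norm_smul, Complex.norm_real, norm_inv, norm_norm]
    exact inv_mul_cancel₀ (norm_ne_zero_iff.mpr (hw i ha hb))
  · intro k; rw [hA0, hscale, h01, mul_zero]
  · intro k; rw [hA1', h10, mul_zero, mul_zero]
  · have hSS : conj S * S = (‖S‖ : ℂ) ^ 2 := by
      rw [mul_comm, Complex.mul_conj, Complex.normSq_eq_norm_sq]; simp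
    have hS0 : (‖S‖ : ℂ) ≠ 0 := by exact_mod_cast norm_ne_zero_iff.mpr h
    calc _ = (conj S / ‖S‖) * (R * conj R) * S := by
          rw [hS, Finset.mul_sum]
          refine Finset.sum_congr rfl fun k _ => ?_
          rw [hA0, hA1', hscale, map_mul]
          ring
      _ = _ := by
          rw [Complex.mul_conj]
          push_cast
          field_simp
          linear_combination (Complex.normSq R : ℂ) * hSS

/-! ### Pure entangled states have an entangled pair of qubits -/

omit [Fintype ι] in
lemma multilinear_piecewise_eq_prod (F : MultilinearMap ℂ (fun _ : ι => Qubit) ℂ)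
    {w : ι → Qubit} (hw : F w = 1)
    (H : ∀ a b : ι, a ≠ b → ∀ (z : ι → Qubit) (u u' v v' : Qubit),
      F (Function.update (Function.update z a u) b v) *
        F (Function.update (Function.update z a u') b v') =
      F (Function.update (Function.update z a u) b v') *
        F (Function.update (Function.update z a u') b v))
    (v : ι → Qubit) (hv : ∀ i, F (Function.update w i (v i)) ≠ 0) (S : Finset ι) :
    F (S.piecewise v w) = ∏ i ∈ S, F (Function.update w i (v i)) := by
  induction S using Finset.strongInduction with
  | H S ih =>
    rcases S.eq_empty_or_nonempty with rfl | ⟨a, ha⟩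
    · simpa using hw
    · rcases (S.erase a).eq_empty_or_nonempty with h | ⟨b, hb⟩
      · obtain rfl : S = {a} := by
          rw [← Finset.insert_erase ha, h]; rfl
        rw [Finset.prod_singleton, Finset.piecewise_singleton]
      · obtain ⟨hba, hbS⟩ := Finset.mem_erase.mp hb
        set T := (S.erase a).erase b with hT
        have hbT : b ∉ T := Finset.notMem_erase _ _
        have haT : a ∉ T := by simp [hT]
        have hbT' : insert b T = S.erase a := Finset.insert_erase hb
        have haS : insert a (insert b T) = S := by rw [hbT', Finset.insert_erase ha]
        have haT' : a ∉ insert b T := by simp [haT, hba.symm]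
        have hsub : insert b T ⊂ S := by rw [hbT']; exact Finset.erase_ssubset ha
        have hsub' : insert a T ⊂ S := by
          rw [Finset.ssubset_iff]
          exact ⟨b, by simp [hbT, hba], by rw [Finset.insert_comm, haS]⟩
        have hsubT : T ⊂ S := (Finset.ssubset_insert hbT).trans hsub
        have e1 := ih T hsubT
        have e2 := ih _ hsub
        have e3 := ih _ hsub'
        have h0 : F (T.piecewise v w) ≠ 0 := by
          rw [e1]; exact Finset.prod_ne_zero_iff.mpr fun i _ => hv i
        have key := H a b hba.symm (T.piecewise v w) (v a) (w a) (v b) (w b)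
        have hwa : Function.update (T.piecewise v w) a (w a) = T.piecewise v w := by
          rw [Function.update_eq_self_iff, Finset.piecewise_eq_of_notMem _ _ _ haT]
        have hwb : Function.update (T.piecewise v w) b (w b) = T.piecewise v w := by
          rw [Function.update_eq_self_iff, Finset.piecewise_eq_of_notMem _ _ _ hbT]
        rw [hwa, hwb, Function.update_comm hba.symm, Function.update_comm hba.symm, hwb,
          ← Finset.piecewise_insert, ← Finset.piecewise_insert, ← Finset.piecewise_insert, haS,
          e1, e2, e3, Finset.prod_insert haT, Finset.prod_insert hbT] at key
        rw [e1] at h0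
        rw [← haS, Finset.prod_insert haT', Finset.prod_insert hbT, haS]
        refine mul_right_cancel₀ h0 (key.trans ?_)
        ring

lemma multilinear_eq_prod (F : MultilinearMap ℂ (fun _ : ι => Qubit) ℂ)
    {w : ι → Qubit} (hw : F w = 1)
    (H : ∀ a b : ι, a ≠ b → ∀ (z : ι → Qubit) (u u' v v' : Qubit),
      F (Function.update (Function.update z a u) b v) *
        F (Function.update (Function.update z a u') b v') =
      F (Function.update (Function.update z a u) b v') *
        F (Function.update (Function.update z a u') b v))
    (v : ι → Qubit) : F v = ∏ i, F (Function.update w i (v i)) := by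
  suffices h : ∀ (B : Finset ι) (v : ι → Qubit), (∀ i ∉ B, F (Function.update w i (v i)) ≠ 0) →
      F v = ∏ i, F (Function.update w i (v i)) from
    h Finset.univ v fun i hi => absurd (Finset.mem_univ i) hi
  intro B
  induction B using Finset.induction_on with
  | empty =>
    intro v hv
    simpa using multilinear_piecewise_eq_prod F hw H v (fun i => hv i (by simp)) Finset.univ
  | insert j B hj ih =>
    intro v hv
    by_cases h0 : F (Function.update w j (v j)) = 0
    · rw [Finset.prod_eq_zero (Finset.mem_univ j) h0]
      have hgood : ∀ x : Qubit, F (Function.update w j x) = 1 →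
          F (Function.update v j x) = ∏ i ∈ Finset.univ.erase j, F (Function.update w i (v i)) := by
        intro x hx
        rw [ih (Function.update v j x), ← Finset.mul_prod_erase _ _ (Finset.mem_univ j)]
        · rw [Function.update_self, hx, one_mul]
          refine Finset.prod_congr rfl fun i hi => ?_
          rw [Function.update_of_ne (Finset.ne_of_mem_erase hi)]
        · intro i hi
          by_cases hij : i = j
          · subst hij; rw [Function.update_self, hx]; exact one_ne_zero
          · rw [Function.update_of_ne hij]; exact hv i (by simp [hi, hij])
      have h1 := hgood (w j) (by rw [Function.update_eq_self, hw])
      have h2 := hgood (v j + w j) (by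
        rw [MultilinearMap.map_update_add, h0, Function.update_eq_self, hw, zero_add])
      rw [MultilinearMap.map_update_add, Function.update_eq_self, h1] at h2
      simpa using h2
    · refine ih v fun i hi => ?_
      by_cases hij : i = j
      · subst hij; exact h0
      · exact hv i (by simp [hi, hij])

lemma norm_tensorKet (v : ι → Qubit) : ‖tensorKet v‖ = ∏ i, ‖v i‖ := by
  refine (sq_eq_sq₀ (norm_nonneg _) (Finset.prod_nonneg fun i _ => norm_nonneg _)).mp ?_
  rw [EuclideanSpace.norm_sq_eq, ← Finset.prod_pow]
  simp only [EuclideanSpace.norm_sq_eq, tensorKet, norm_prod, Finset.prod_univ_sum,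
    Fintype.piFinset_univ, ← Finset.prod_pow]

omit [Fintype ι] [DecidableEq ι] in
lemma ketbra_smul (z : ℂ) (ψ : Ket ι) : ketbra (z • ψ) = (z * conj z) • ketbra ψ := by
  ext s t
  simp [ketbra]
  ring

lemma trace_ketbra (ψ : Ket ι) : (ketbra ψ).trace = (‖ψ‖ : ℂ) ^ 2 := by
  rw [← Complex.ofReal_pow, EuclideanSpace.norm_sq_eq]
  simp [Matrix.trace, ketbra, Complex.mul_conj, Complex.normSq_eq_norm_sq]

omit [DecidableEq ι] in
lemma isSeparable_of_tensorKet {v : ι → Qubit} (hv : ∀ i, ‖v i‖ = 1) :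
    IsSeparable (ketbra (tensorKet v)) :=
  subset_convexHull ℝ _ ⟨v, hv, rfl⟩

lemma isSeparable_of_smul_tensorKet {ψ : Ket ι} (hψ : ‖ψ‖ = 1) {z : ℂ} {x : ι → Qubit}
    (h : ψ = z • tensorKet x) : IsSeparable (ketbra ψ) := by
  have hn : ‖z‖ * ∏ i, ‖x i‖ = 1 := by rw [← norm_tensorKet, ← norm_smul, ← h, hψ]
  have hx : ∀ i, ‖x i‖ ≠ 0 := fun i h0 => by
    rw [Finset.prod_eq_zero (Finset.mem_univ i) h0, mul_zero] at hn
    exact zero_ne_one hn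
  have h1 : tensorKet (fun i => ((‖x i‖⁻¹ : ℝ) : ℂ) • x i) =
      (((∏ i, ‖x i‖)⁻¹ : ℝ) : ℂ) • tensorKet x := by
    ext s
    simp [tensorKet, Finset.prod_mul_distrib]
  have h2 : ketbra ψ = ketbra (tensorKet fun i => ((‖x i‖⁻¹ : ℝ) : ℂ) • x i) := by
    have hz : ‖z‖ = (∏ i, ‖x i‖)⁻¹ := eq_inv_of_mul_eq_one_left hn
    rw [h, h1, ketbra_smul, ketbra_smul, ← hz, Complex.mul_conj, Complex.mul_conj,
      Complex.normSq_eq_norm_sq, Complex.normSq_eq_norm_sq, Complex.norm_real, norm_norm]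
  rw [h2]
  refine isSeparable_of_tensorKet fun i => ?_
  rw [norm_smul, Complex.norm_real, norm_inv, norm_norm, inv_mul_cancel₀ (hx i)]

/-- An entangled pure state can be projected, by projecting all but two of the qubits onto suitable
vectors, onto an entangled pure state of these two qubits. -/
theorem exists_entangled_pair {ψ : Ket ι} (hψ : ‖ψ‖ = 1) (hent : ¬ IsSeparable (ketbra ψ)) :
    ∃ a b : ι, a ≠ b ∧ ∃ (w : ι → Qubit) (u u' v v' : Qubit),
      overlap ψ (Function.update (Function.update w a u) b v) *
        overlap ψ (Function.update (Function.update w a u') b v') ≠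
      overlap ψ (Function.update (Function.update w a u) b v') *
        overlap ψ (Function.update (Function.update w a u') b v) := by
  by_contra! H
  apply hent
  obtain ⟨s, hs⟩ : ∃ s, ψ s ≠ 0 := by
    by_contra! h0
    have : ψ = 0 := by ext s; simpa using h0 s
    rw [this, norm_zero] at hψ
    exact zero_ne_one hψ
  set w : ι → Qubit := fun i => EuclideanSpace.single (s i) 1 with hw
  have hFw : overlap ψ w ≠ 0 := by rw [hw, overlap_single]; simpa using hs
  set F := (overlap ψ w)⁻¹ • overlap ψ with hF
  have hprod := multilinear_eq_prod F (w := w) (by simp [hF, hFw]) (by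
    intro a b hab z u u' v v'
    simp only [hF, smul_apply, smul_eq_mul]
    linear_combination ((overlap ψ w)⁻¹ * (overlap ψ w)⁻¹) * H a b hab z u u' v v')
  refine isSeparable_of_smul_tensorKet hψ (z := conj (overlap ψ w))
    (x := fun i => WithLp.toLp 2 fun c =>
      conj (F (Function.update w i (EuclideanSpace.single c 1)))) ?_
  ext t
  have h1 := hprod fun i => EuclideanSpace.single (t i) 1
  have h2 : overlap ψ (fun i => EuclideanSpace.single (t i) 1) =
      overlap ψ w * F (fun i => EuclideanSpace.single (t i) 1) := by
    rw [hF, smul_apply, smul_eq_mul, mul_inv_cancel_left₀ hFw]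
  rw [h1, overlap_single] at h2
  rw [← Complex.conj_conj (ψ t), h2]
  simp [tensorKet]

/-! ### The Schmidt decomposition of two qubits -/

lemma bilinear_apply_eq_sum (G : Qubit →ₗ[ℂ] Qubit →ₗ[ℂ] ℂ) (u v : Qubit) :
    G u v = ∑ t, v t * G u (EuclideanSpace.single t 1) := by
  conv_lhs => rw [← (EuclideanSpace.basisFun (Fin 2) ℂ).sum_repr v]
  simp

lemma exists_schmidt (G : Qubit →ₗ[ℂ] Qubit →ₗ[ℂ] ℂ)
    (h : ∃ u u' v v', G u v * G u' v' ≠ G u v' * G u' v) :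
    ∃ A B : QubitMeasurement, G (A 0) (B 1) = 0 ∧ G (A 1) (B 0) = 0 ∧
      G (A 0) (B 0) ≠ 0 ∧ G (A 1) (B 1) ≠ 0 := by
  let T : Qubit →ₗ[ℂ] Qubit :=
    { toFun := fun u => WithLp.toLp 2 fun t => G u (EuclideanSpace.single t 1)
      map_add' := fun u v => by ext t; simp
      map_smul' := fun z u => by ext t; simp }
  have hTG : ∀ u v, G u v = ∑ t, v t * T u t := bilinear_apply_eq_sum G
  have hsym := LinearMap.isSymmetric_adjoint_mul_self T
  let A : QubitMeasurement := hsym.eigenvectorBasis (by simp)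
  have horth : inner ℂ (T (A 0)) (T (A 1)) = 0 := by
    have h1 := hsym.apply_eigenvectorBasis (n := 2) (by simp) 1
    rw [← LinearMap.adjoint_inner_right]
    change inner ℂ (A 0) ((LinearMap.adjoint T * T) (A 1)) = 0
    change (LinearMap.adjoint T * T) (A 1) = _ • A 1 at h1
    rw [h1, inner_smul_right, A.orthonormal.2 (by decide), mul_zero]
  have hne : ∀ c : Fin 2, T (A c) ≠ 0 := by
    intro c hc
    have hz : ∀ v, G (A c) v = 0 := fun v => by rw [hTG, hc]; simp
    have hu : ∀ u v, G u v = A.repr u (1 - c) * G (A (1 - c)) v := by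
      intro u v
      conv_lhs => rw [← A.sum_repr u]
      fin_cases c <;> simp_all
    obtain ⟨u, u', v, v', hh⟩ := h
    apply hh
    rw [hu u v, hu u' v', hu u v', hu u' v]
    ring
  let y : Fin 2 → Qubit := fun c => WithLp.toLp 2 fun t => conj (T (A c) t)
  have hy : ∀ c, ‖y c‖ = ‖T (A c)‖ := fun c => by simp [y, EuclideanSpace.norm_eq]
  have hy0 : ∀ c, ‖y c‖ ≠ 0 := fun c => by rw [hy]; exact norm_ne_zero_iff.mpr (hne c)
  have hyn : ∀ c, ‖((‖y c‖⁻¹ : ℝ) : ℂ) • y c‖ = 1 := fun c => by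
    rw [norm_smul, Complex.norm_real, norm_inv, norm_norm, inv_mul_cancel₀ (hy0 c)]
  have hGy : ∀ c d, G (A c) (y d) = inner ℂ (T (A d)) (T (A c)) := by
    intro c d
    rw [hTG]
    simp [y, PiLp.inner_apply, mul_comm]
  have hyy : inner ℂ (y 0) (y 1) = 0 := by
    rw [← inner_eq_zero_symm.mp horth]
    simp [y, PiLp.inner_apply, mul_comm]
  obtain ⟨B, hB0, hB1⟩ := exists_measurement (hyn 0) (hyn 1)
    (by rw [inner_smul_left, inner_smul_right, hyy, mul_zero, mul_zero])
  have hs : ∀ c, G (A c) (((‖y c‖⁻¹ : ℝ) : ℂ) • y c) ≠ 0 := by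
    intro c
    rw [map_smul, smul_eq_mul, hGy]
    refine mul_ne_zero ?_ (inner_self_ne_zero.mpr (hne c))
    exact_mod_cast inv_ne_zero (hy0 c)
  refine ⟨A, B, ?_, ?_, ?_, ?_⟩
  · rw [hB1, map_smul, hGy, inner_eq_zero_symm.mp horth, smul_zero]
  · rw [hB0, map_smul, hGy, horth, smul_zero]
  · rw [hB0]; exact hs 0
  · rw [hB1]; exact hs 1

/-- The bilinear form of two qubits `a` and `b`, obtained from a state vector by projecting the
other qubits onto the vectors `w`. -/
def pairForm (ψ : Ket ι) {a b : ι} (hab : a ≠ b) (w : ι → Qubit) : Qubit →ₗ[ℂ] Qubit →ₗ[ℂ] ℂ :=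
  LinearMap.mk₂ ℂ (fun u v => overlap ψ (Function.update (Function.update w a u) b v))
    (fun u u' v => by simp only [Function.update_comm hab, MultilinearMap.map_update_add])
    (fun z u v => by simp only [Function.update_comm hab, MultilinearMap.map_update_smul])
    (fun u v v' => by simp only [MultilinearMap.map_update_add])
    (fun z u v => by simp only [MultilinearMap.map_update_smul])

lemma exists_schmidt_pair (ψ : Ket ι) {a b : ι} (hab : a ≠ b) (w : ι → Qubit)
    (h : ∃ u u' v v', overlap ψ (Function.update (Function.update w a u) b v) *
        overlap ψ (Function.update (Function.update w a u') b v') ≠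
      overlap ψ (Function.update (Function.update w a u) b v') *
        overlap ψ (Function.update (Function.update w a u') b v)) :
    ∃ A B : QubitMeasurement,
      overlap ψ (Function.update (Function.update w a (A 0)) b (B 1)) = 0 ∧
      overlap ψ (Function.update (Function.update w a (A 1)) b (B 0)) = 0 ∧
      overlap ψ (Function.update (Function.update w a (A 0)) b (B 0)) ≠ 0 ∧
      overlap ψ (Function.update (Function.update w a (A 1)) b (B 1)) ≠ 0 :=
  exists_schmidt (pairForm ψ hab w) h

/-- Entangled pure states violate local realism. -/
theorem violates_of_pure_entangled {ψ : Ket ι} (hψ : ‖ψ‖ = 1)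
    (hent : ¬ IsSeparable (ketbra ψ)) : ViolatesLocalRealism (ketbra ψ) := by
  obtain ⟨a, b, hab, w, h⟩ := exists_entangled_pair hψ hent
  obtain ⟨A, B, h01, h10, h00, h11⟩ := exists_schmidt_pair ψ hab w h
  refine violates_of_correlated (Ψ := fun _ : Unit => ψ) (by simp [Decomposes]) hab w A B
    (fun _ => h01) (fun _ => h10) ?_
  simp [h00, h11]

/-! ### Partial inner products -/

/-- The partial inner product `⟨u|ψ⟩` with a vector `u` of qubit `k`, as a vector that does not
depend on the label of qubit `k`. -/
def contract (k : ι) (u : Qubit) (ψ : Ket ι) : Ket ι :=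
  WithLp.toLp 2 fun s => ∑ c, conj (u c) * ψ (Function.update s k c)

omit [Fintype ι] in
lemma contract_apply (k : ι) (u : Qubit) (ψ : Ket ι) (s : ι → Fin 2) :
    contract k u ψ s = ∑ c, conj (u c) * ψ (Function.update s k c) := rfl

omit [Fintype ι] in
lemma contract_smul (k : ι) (u : Qubit) (z : ℂ) (ψ : Ket ι) :
    contract k u (z • ψ) = z • contract k u ψ := by
  ext s
  simp [contract_apply]
  ring

omit [Fintype ι] in
lemma contract_sum {K : Type*} (S : Finset K) (k : ι) (u : Qubit) (Ψ : K → Ket ι) :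
    contract k u (∑ j ∈ S, Ψ j) = ∑ j ∈ S, contract k u (Ψ j) := by
  ext s
  simp only [contract_apply, WithLp.ofLp_sum, Finset.sum_apply, Finset.mul_sum]
  rw [Finset.sum_comm]

omit [Fintype ι] in
lemma contract_zero (k : ι) (u : Qubit) : contract k u (0 : Ket ι) = 0 := by
  ext s
  simp [contract_apply]

omit [Fintype ι] in
lemma contract_comm {a b : ι} (hab : a ≠ b) (u v : Qubit) (ψ : Ket ι) :
    contract a u (contract b v ψ) = contract b v (contract a u ψ) := by
  ext s
  simp only [contract_apply, Finset.mul_sum]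
  rw [Finset.sum_comm]
  refine Finset.sum_congr rfl fun c _ => Finset.sum_congr rfl fun d _ => ?_
  rw [Function.update_comm hab]
  ring

omit [Fintype ι] in
lemma contract_resolution (A : QubitMeasurement) (k : ι) (ψ : Ket ι) (s : ι → Fin 2) :
    ψ s = ∑ c, A c (s k) * contract k (A c) ψ s := by
  have h := congrArg (fun x : Qubit => x (s k))
    (A.sum_repr' (WithLp.toLp 2 fun i => ψ (Function.update s k i)))
  simp only [Function.update_eq_self] at h
  rw [← h]
  simp [contract_apply, PiLp.inner_apply, mul_comm]

omit [Fintype ι] in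
lemma eq_zero_of_contract (A : QubitMeasurement) (k : ι) {ψ : Ket ι}
    (h : ∀ c, contract k (A c) ψ = 0) : ψ = 0 := by
  ext s
  rw [contract_resolution A k ψ s]
  simp [h]

omit [Fintype ι] in
lemma contract_mul (k : ι) (u e : Qubit) {ψ φ : Ket ι} (hφ : ∀ s i, φ (Function.update s k i) = φ s)
    (h : ∀ s, ψ s = e (s k) * φ s) : contract k u ψ = inner ℂ u e • φ := by
  ext s
  simp [contract_apply, h, hφ, PiLp.inner_apply]
  ring

omit [Fintype ι] in
lemma glue_restrict (k : ι) (c : Fin 2) (s : ι → Fin 2) :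
    glue k c (fun j => s j) = Function.update s k c := by
  funext j
  by_cases h : j = k
  · subst h; simp [glue]
  · simp [glue, h]

omit [Fintype ι] in
lemma Decomposes.collapse {K : Type*} [Fintype K] {ρ : Operator ι} {Ψ : K → Ket ι}
    (h : Decomposes ρ Ψ) (k : ι) (u : Qubit) (s t : ι → Fin 2) :
    NQubit.collapse ρ k u (fun j => s j) (fun j => t j) =
      ∑ j, contract k u (Ψ j) s * conj (contract k u (Ψ j) t) := by
  simp only [NQubit.collapse, Matrix.of_apply, glue_restrict, h.apply, contract_apply, map_sum,
    map_mul, Complex.conj_conj, Finset.mul_sum, Finset.sum_mul]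
  rw [Finset.sum_comm]
  conv_rhs => rw [Finset.sum_comm]
  refine Finset.sum_congr rfl fun c _ => ?_
  conv_rhs => rw [Finset.sum_comm]
  refine Finset.sum_congr rfl fun d _ => Finset.sum_congr rfl fun j _ => ?_
  ring

omit [Fintype ι] [DecidableEq ι] in
/-- The vectors in a decomposition of a rank one operator are multiples of a single vector. -/
lemma exists_smul_of_rank_one {K : Type*} [Fintype K] {v : K → Ket ι} {φ : Ket ι} {p : ℂ}
    (h : ∀ s t, ∑ j, v j s * conj (v j t) = p * (φ s * conj (φ t))) (hφ : φ ≠ 0) (j : K) :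
    ∃ α : ℂ, v j = α • φ := by
  obtain ⟨s₀, hs₀⟩ : ∃ s, φ s ≠ 0 := by
    by_contra! h0
    exact hφ (by ext s; simpa using h0 s)
  refine ⟨v j s₀ / φ s₀, ?_⟩
  ext s
  have hsum : ∑ j, (Complex.normSq (v j s * φ s₀ - v j s₀ * φ s) : ℂ) = 0 := by
    calc _ = φ s₀ * conj (φ s₀) * ∑ j, v j s * conj (v j s)
          - φ s₀ * conj (φ s) * ∑ j, v j s * conj (v j s₀)
          - φ s * conj (φ s₀) * ∑ j, v j s₀ * conj (v j s)
          + φ s * conj (φ s) * ∑ j, v j s₀ * conj (v j s₀) := by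
          simp only [Finset.mul_sum, ← Finset.sum_sub_distrib, ← Finset.sum_add_distrib]
          refine Finset.sum_congr rfl fun j _ => ?_
          rw [← Complex.mul_conj]
          simp only [map_sub, map_mul]
          ring
      _ = 0 := by
          simp only [h]
          ring
  have hsum' : ∑ j, Complex.normSq (v j s * φ s₀ - v j s₀ * φ s) = 0 := by exact_mod_cast hsum
  rw [Finset.sum_eq_zero_iff_of_nonneg fun k _ => Complex.normSq_nonneg _] at hsum'
  have h0 := Complex.normSq_eq_zero.mp (hsum' j (Finset.mem_univ j))
  rw [PiLp.smul_apply, smul_eq_mul]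
  field_simp
  linear_combination h0

/-- If qubit `k` can steer the others, then all the vectors in a decomposition of the state lie in
the span of two vectors `A c ⊗ φ c`. -/
lemma CanSteer.exists_structure {K : Type*} [Fintype K] {ρ : Operator ι} {Ψ : K → Ket ι}
    (hρ : Decomposes ρ Ψ) {k : ι} (hk : CanSteer ρ k) :
    ∃ (A : QubitMeasurement) (φ : Fin 2 → Ket ι) (α : K → Fin 2 → ℂ),
      (∀ c, φ c ≠ 0) ∧ (∀ c s i, φ c (Function.update s k i) = φ c s) ∧
      ∀ j c, contract k (A c) (Ψ j) = α j c • φ c := by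
  obtain ⟨A, hA, -⟩ := hk
  choose hp φ hφ1 hφ using hA
  have hne : ∀ c, (WithLp.toLp 2 fun s => φ c (fun j => s j) : Ket ι) ≠ 0 := by
    intro c h0
    have : φ c = 0 := by
      ext t
      have h1 := congrArg (fun x : Ket ι => x (glue k 0 t)) h0
      have h2 : (fun j : {j // j ≠ k} => glue k 0 t j) = t := by
        funext j
        simp [glue, j.2]
      simpa [h2] using h1
    have h3 := hφ1 c
    rw [this, norm_zero] at h3
    exact zero_ne_one h3
  have hex : ∀ j c, ∃ α : ℂ,
      contract k (A c) (Ψ j) = α • (WithLp.toLp 2 fun s => φ c (fun j => s j) : Ket ι) := by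
    intro j c
    refine exists_smul_of_rank_one (v := fun j => contract k (A c) (Ψ j))
      (p := outcomeProb ρ k (A c)) (fun s t => ?_) (hne c) j
    rw [← hρ.collapse]
    have h1 := congrArg (fun X => outcomeProb ρ k (A c) • X) (hφ c)
    simp only [steeredState, smul_inv_smul₀ (hp c)] at h1
    rw [h1]
    rfl
  choose α hα using hex
  refine ⟨A, _, α, hne, fun c s i => ?_, hα⟩
  exact congrArg (φ c).ofLp (funext fun j => Function.update_of_ne j.2 _ _)

/-! ### Mixtures in the span of two vectors -/

omit [Fintype ι] [DecidableEq ι] in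
/-- The matrix entries of `ρ` in terms of the Gram matrix of the coefficients. -/
lemma Decomposes.apply_span_two {K : Type*} [Fintype K] {ρ : Operator ι} {Ψ : K → Ket ι}
    (hρ : Decomposes ρ Ψ) {η : Fin 2 → Ket ι} {α : K → Fin 2 → ℂ}
    (h : ∀ j, Ψ j = ∑ c, α j c • η c) (s t : ι → Fin 2) :
    ρ s t = (∑ j, Complex.normSq (α j 0) : ℝ) * (η 0 s * conj (η 0 t)) +
      (∑ j, α j 0 * conj (α j 1)) * (η 0 s * conj (η 1 t)) +
      conj (∑ j, α j 0 * conj (α j 1)) * (η 1 s * conj (η 0 t)) +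
      (∑ j, Complex.normSq (α j 1) : ℝ) * (η 1 s * conj (η 1 t)) := by
  rw [hρ.apply]
  push_cast
  simp only [h, Fin.sum_univ_two, map_sum, Finset.sum_mul, ← Finset.sum_add_distrib]
  refine Finset.sum_congr rfl fun j _ => ?_
  rw [← Complex.mul_conj, ← Complex.mul_conj]
  simp
  ring

lemma normSq_sum_mul_conj_le {K : Type*} [Fintype K] (x y : K → ℂ) :
    Complex.normSq (∑ j, x j * conj (y j)) ≤
      (∑ j, Complex.normSq (x j)) * ∑ j, Complex.normSq (y j) := by
  have h := norm_inner_le_norm (𝕜 := ℂ) (WithLp.toLp 2 y : EuclideanSpace ℂ K) (WithLp.toLp 2 x)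
  have h2 := pow_le_pow_left₀ (norm_nonneg _) h 2
  rw [mul_pow, EuclideanSpace.norm_sq_eq, EuclideanSpace.norm_sq_eq, mul_comm] at h2
  simpa [Complex.normSq_eq_norm_sq, PiLp.inner_apply] using h2

/-- A vanishing Gram determinant means that the state is pure. -/
lemma isPure_of_gram_eq {ρ : Operator ι} (htr : ρ.trace = 1) {η : Fin 2 → Ket ι} {p q : ℝ} {x : ℂ}
    (hp : 0 ≤ p) (hq : 0 ≤ q) (hx : Complex.normSq x = p * q)
    (h : ∀ s t, ρ s t = p * (η 0 s * conj (η 0 t)) + x * (η 0 s * conj (η 1 t)) +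
      conj x * (η 1 s * conj (η 0 t)) + q * (η 1 s * conj (η 1 t))) : IsPure ρ := by
  have key : ∃ ψ, ρ = ketbra ψ := by
    rcases hp.eq_or_lt with hp0 | hp0
    · have hx0 : x = 0 := by rw [← hp0, zero_mul] at hx; exact Complex.normSq_eq_zero.mp hx
      refine ⟨(Real.sqrt q : ℂ) • η 1, ?_⟩
      rw [ketbra_smul, Complex.conj_ofReal, ← Complex.ofReal_mul, Real.mul_self_sqrt hq]
      ext s t
      simp [h, ← hp0, hx0, ketbra]
    · have hs : (Real.sqrt p : ℂ) * Real.sqrt p = p := by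
        rw [← Complex.ofReal_mul, Real.mul_self_sqrt hp]
      have hs0 : (Real.sqrt p : ℂ) ≠ 0 := by
        exact_mod_cast (Real.sqrt_pos.mpr hp0).ne'
      refine ⟨(Real.sqrt p : ℂ) • η 0 + (conj x / Real.sqrt p) • η 1, ?_⟩
      have hxx : conj x / Real.sqrt p * (x / Real.sqrt p) = q := by
        rw [div_mul_div_comm, hs, mul_comm, Complex.mul_conj, hx]
        have : (p : ℂ) ≠ 0 := by exact_mod_cast hp0.ne'
        push_cast
        field_simp
      ext s t
      rw [h, ← hs, ← hxx]
      simp [ketbra]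
      field_simp
      ring
  obtain ⟨ψ, hψ⟩ := key
  refine ⟨ψ, ?_, hψ⟩
  rw [hψ, trace_ketbra] at htr
  have : ‖ψ‖ ^ 2 = 1 := by exact_mod_cast htr
  exact (pow_eq_one_iff_of_nonneg (norm_nonneg _) two_ne_zero).mp this

omit [Fintype ι] [DecidableEq ι] in
/-- If the Gram determinant does not vanish, then both vectors are combinations of the `Ψ j`. -/
lemma mem_span_of_gram {K : Type*} [Fintype K] {Ψ : K → Ket ι} {η : Fin 2 → Ket ι}
    {α : K → Fin 2 → ℂ} (h : ∀ j, Ψ j = ∑ c, α j c • η c)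
    (hdet : Complex.normSq (∑ j, α j 0 * conj (α j 1)) <
      (∑ j, Complex.normSq (α j 0)) * ∑ j, Complex.normSq (α j 1)) (c : Fin 2) :
    ∃ β : K → ℂ, η c = ∑ j, β j • Ψ j := by
  set p := ∑ j, Complex.normSq (α j 0) with hp
  set q := ∑ j, Complex.normSq (α j 1) with hq
  set x := ∑ j, α j 0 * conj (α j 1) with hx
  have hp' : (p : ℂ) = ∑ j, α j 0 * conj (α j 0) := by simp [hp, Complex.mul_conj]
  have hq' : (q : ℂ) = ∑ j, α j 1 * conj (α j 1) := by simp [hq, Complex.mul_conj]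
  have hx' : conj x = ∑ j, α j 1 * conj (α j 0) := by simp [hx, mul_comm]
  have hD : (p * q - x * conj x : ℂ) ≠ 0 := by
    rw [Complex.mul_conj]
    have : p * q - Complex.normSq x ≠ 0 := (sub_pos.mpr hdet).ne'
    exact_mod_cast this
  have hcomb : ∀ y z : ℂ, ∑ j, (y * conj (α j 0) + z * conj (α j 1)) • Ψ j =
      (y * p + z * x) • η 0 + (y * conj x + z * q) • η 1 := by
    intro y z
    rw [hp', hq', hx', hx]
    simp only [h, Fin.sum_univ_two, Finset.mul_sum, ← Finset.sum_add_distrib, Finset.sum_smul]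
    refine Finset.sum_congr rfl fun j _ => ?_
    module
  fin_cases c
  · refine ⟨fun j => (p * q - x * conj x : ℂ)⁻¹ * (q * conj (α j 0) + -conj x * conj (α j 1)), ?_⟩
    simp only [mul_smul, ← Finset.smul_sum, hcomb]
    rw [eq_inv_smul_iff₀ hD]
    simp only [Fin.zero_eta]
    module
  · refine ⟨fun j => (p * q - x * conj x : ℂ)⁻¹ * (-x * conj (α j 0) + p * conj (α j 1)), ?_⟩
    simp only [mul_smul, ← Finset.smul_sum, hcomb]
    rw [eq_inv_smul_iff₀ hD]
    simp only [Fin.mk_one]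
    module

/-! ### Product vectors with respect to two qubits -/

/-- Splitting off the labels of two qubits. -/
def splitPair {a b : ι} (hab : a ≠ b) :
    (ι → Fin 2) ≃ Fin 2 × Fin 2 × ({j : ι // j ≠ a ∧ j ≠ b} → Fin 2) where
  toFun s := (s a, s b, fun j => s j)
  invFun x j := if ha : j = a then x.1 else if hb : j = b then x.2.1 else x.2.2 ⟨j, ha, hb⟩
  left_inv s := by
    funext j
    by_cases ha : j = a
    · simp [ha]
    · by_cases hb : j = b
      · subst hb; simp [ha]
      · simp [ha, hb]
  right_inv x := by
    obtain ⟨i, j, t⟩ := x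
    refine Prod.ext (by simp) (Prod.ext (by simp [hab.symm]) ?_)
    funext k
    simp [k.2.1, k.2.2]

lemma sum_splitPair {a b : ι} (hab : a ≠ b)
    (f : Fin 2 → Fin 2 → ({j : ι // j ≠ a ∧ j ≠ b} → Fin 2) → ℂ) :
    ∑ s : ι → Fin 2, f (s a) (s b) (fun j => s j) = ∑ i, ∑ j, ∑ t, f i j t := by
  have := (splitPair hab).sum_comp fun x => f x.1 x.2.1 x.2.2
  rw [Fintype.sum_prod_type] at this
  simp only [Fintype.sum_prod_type] at this
  exact this

lemma prod_splitPair {a b : ι} (hab : a ≠ b) (f : ι → ℂ) :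
    ∏ i, f i = f a * f b * ∏ i : {j : ι // j ≠ a ∧ j ≠ b}, f i := by
  rw [prod_pair_mul hab, Finset.prod_subtype (p := fun j => j ≠ a ∧ j ≠ b)]
  intro x
  simp [and_comm]

lemma inner_pairKet {a b : ι} (hab : a ≠ b) (u v u' v' : Qubit)
    (χ χ' : Ket {j : ι // j ≠ a ∧ j ≠ b}) :
    inner ℂ (pairKet a b u v χ) (pairKet a b u' v' χ') =
      inner ℂ u u' * inner ℂ v v' * inner ℂ χ χ' := by
  have h := sum_splitPair hab fun i j t =>
    (u' i * conj (u i)) * (v' j * conj (v j)) * (χ' t * conj (χ t))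
  simp only [PiLp.inner_apply, RCLike.inner_apply]
  rw [Finset.sum_mul_sum, Finset.sum_mul]
  simp only [Finset.sum_mul_sum]
  rw [← h]
  refine Finset.sum_congr rfl fun s _ => ?_
  simp only [pairKet, map_mul]
  ring

lemma norm_pairKet {a b : ι} (hab : a ≠ b) {u v : Qubit} (hu : ‖u‖ = 1) (hv : ‖v‖ = 1)
    (χ : Ket {j : ι // j ≠ a ∧ j ≠ b}) : ‖pairKet a b u v χ‖ = ‖χ‖ := by
  have h := inner_pairKet hab u v u v χ χ
  simp only [inner_self_eq_norm_sq_to_K, hu, hv] at h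
  have h2 : ‖pairKet a b u v χ‖ ^ 2 = ‖χ‖ ^ 2 := by
    rw [← Complex.ofReal_inj]
    simpa using h
  exact (sq_eq_sq₀ (norm_nonneg _) (norm_nonneg _)).mp h2

lemma overlap_pairKet {a b : ι} (hab : a ≠ b) (e f : Qubit)
    (χ : Ket {j : ι // j ≠ a ∧ j ≠ b}) (v : ι → Qubit) :
    overlap (pairKet a b e f χ) v =
      inner ℂ e (v a) * inner ℂ f (v b) * overlap χ (fun j => v j) := by
  have h := sum_splitPair hab fun i j t =>
    (v a i * conj (e i)) * (v b j * conj (f j)) * (conj (χ t) * ∏ k : {j : ι // j ≠ a ∧ j ≠ b}, v k (t k))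
  simp only [overlap_apply, PiLp.inner_apply, RCLike.inner_apply]
  rw [Finset.sum_mul_sum, Finset.sum_mul]
  simp only [Finset.sum_mul_sum]
  rw [← h]
  refine Finset.sum_congr rfl fun s _ => ?_
  rw [prod_splitPair hab]
  simp only [pairKet, map_mul]
  ring

omit [Fintype ι] [DecidableEq ι] in
lemma pairKet_smul (a b : ι) (u v : Qubit) (z : ℂ) (χ : Ket {j : ι // j ≠ a ∧ j ≠ b}) :
    pairKet a b u v (z • χ) = z • pairKet a b u v χ := by
  ext s
  simp [pairKet]
  ring

omit [Fintype ι] in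
lemma exists_eq_pairKet {a b : ι} (hab : a ≠ b) (A B : QubitMeasurement) (c : Fin 2) {η : Ket ι}
    (hA : ∀ d, d ≠ c → contract a (A d) η = 0) (hB : ∀ d, d ≠ c → contract b (B d) η = 0) :
    ∃ χ, η = pairKet a b (A c) (B c) χ := by
  refine ⟨WithLp.toLp 2 fun t => contract b (B c) (contract a (A c) η)
    fun j => if h : j ≠ a ∧ j ≠ b then t ⟨j, h⟩ else 0, ?_⟩
  ext s
  rw [contract_resolution A a η s, Finset.sum_eq_single c (fun d _ hd => by simp [hA d hd])
    (by simp), contract_resolution B b (contract a (A c) η) s,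
    Finset.sum_eq_single c (fun d _ hd => by
      rw [contract_comm hab.symm, hB d hd, contract_zero]; simp) (by simp)]
  simp only [pairKet, mul_assoc]
  congr 2
  simp only [contract_apply]
  refine Finset.sum_congr rfl fun i _ => ?_
  congr 1
  refine Finset.sum_congr rfl fun j _ => ?_
  refine congrArg (fun x => _ * η.ofLp x) (funext fun k => ?_)
  by_cases hka : k = a
  · subst hka; simp
  · by_cases hkb : k = b
    · subst hkb; simp [hka]
    · simp [hka, hkb]

omit [Fintype ι] in
/-- If the contractions of two vectors, which are orthogonal on qubit `a`, with a vector of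
qubit `b` are proportional, then one of them vanishes. -/
lemma contract_eq_zero_or {a b : ι} (hab : a ≠ b) (A : QubitMeasurement) (f : Qubit)
    {η : Fin 2 → Ket ι} (h01 : contract a (A 1) (η 0) = 0) (h10 : contract a (A 0) (η 1) = 0)
    {χ : Ket ι} (hχ : ∀ c, ∃ μ : ℂ, contract b f (η c) = μ • χ) :
    contract b f (η 0) = 0 ∨ contract b f (η 1) = 0 := by
  obtain ⟨μ, hμ⟩ := hχ 0
  obtain ⟨ν, hν⟩ := hχ 1
  by_contra! hne
  have hμ0 : μ ≠ 0 := by rintro rfl; exact hne.1 (by simpa using hμ)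
  have hν0 : ν ≠ 0 := by rintro rfl; exact hne.2 (by simpa using hν)
  have h1 : contract a (A 1) χ = 0 := by
    have := congrArg (contract a (A 1)) hμ
    rw [contract_comm hab, h01, contract_zero, contract_smul] at this
    exact (smul_eq_zero.mp this.symm).resolve_left hμ0
  have h0 : contract a (A 0) χ = 0 := by
    have := congrArg (contract a (A 0)) hν
    rw [contract_comm hab, h10, contract_zero, contract_smul] at this
    exact (smul_eq_zero.mp this.symm).resolve_left hν0
  have : χ = 0 := eq_zero_of_contract A a fun c => by fin_cases c <;> assumption
  exact hne.1 (by rw [hμ, this, smul_zero])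

/-- The vectors of a state in the span of two product vectors `A c ⊗ B c ⊗ χ c`. -/
lemma exists_pairKet_structure {K : Type*} [Fintype K] {ρ : Operator ι} {Ψ : K → Ket ι}
    (hρ : Decomposes ρ Ψ) {a b : ι} (hab : a ≠ b) {A : QubitMeasurement} {η : Fin 2 → Ket ι}
    (hη : ∀ c, η c ≠ 0) (hA : ∀ c d, d ≠ c → contract a (A d) (η c) = 0)
    (hspan : ∀ c, ∃ β : K → ℂ, η c = ∑ j, β j • Ψ j) (hb : CanSteer ρ b) :
    ∃ (B : QubitMeasurement) (χ : Fin 2 → Ket {j : ι // j ≠ a ∧ j ≠ b}),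
      ∀ c, η c = pairKet a b (A c) (B c) (χ c) := by
  obtain ⟨B, φ, α, -, -, hB⟩ := hb.exists_structure hρ
  have hprop : ∀ d c, ∃ μ : ℂ, contract b (B d) (η c) = μ • φ d := by
    intro d c
    obtain ⟨β, hβ⟩ := hspan c
    refine ⟨∑ j, β j * α j d, ?_⟩
    rw [hβ, contract_sum, Finset.sum_smul]
    simp only [contract_smul, hB, mul_smul]
  have hzero : ∀ d, contract b (B d) (η 0) = 0 ∨ contract b (B d) (η 1) = 0 := fun d =>
    contract_eq_zero_or hab A (B d) (hA 0 1 (by decide)) (hA 1 0 (by decide)) (hprop d)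
  have hnot : ∀ c, ¬ (contract b (B 0) (η c) = 0 ∧ contract b (B 1) (η c) = 0) := fun c h =>
    hη c (eq_zero_of_contract B b fun d => by fin_cases d; exacts [h.1, h.2])
  obtain ⟨B', hB'⟩ : ∃ B' : QubitMeasurement, ∀ c d, d ≠ c → contract b (B' d) (η c) = 0 := by
    have h0 := hnot 0
    have h1 := hnot 1
    rcases hzero 0 with h | h <;> rcases hzero 1 with h' | h'
    · exact absurd ⟨h, h'⟩ h0
    · refine ⟨B.reindex (Equiv.swap 0 1), fun c d hd => ?_⟩
      fin_cases c <;> fin_cases d <;> simp_all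
    · refine ⟨B, fun c d hd => ?_⟩
      fin_cases c <;> fin_cases d <;> simp_all
    · exact absurd ⟨h, h'⟩ h1
  choose χ hχ using fun c => exists_eq_pairKet hab A B' c (hA c) (hB' c)
  exact ⟨B', χ, hχ⟩

/-! ### The form of the mixed states -/

/-- A positive definite real symmetric matrix of trace one, diagonalized by a rotation. -/
lemma exists_rotation_diagonalizing {p q r : ℝ} (h1 : p + q = 1) (hdet : r ^ 2 < p * q) :
    ∃ ζ ν₁ ν₂ : ℝ, 0 < ν₁ ∧ 0 < ν₂ ∧ ν₁ + ν₂ = 1 ∧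
      p = ν₁ * Real.cos (ζ / 2) ^ 2 + ν₂ * Real.sin (ζ / 2) ^ 2 ∧
      q = ν₁ * Real.sin (ζ / 2) ^ 2 + ν₂ * Real.cos (ζ / 2) ^ 2 ∧
      r = (ν₁ - ν₂) * (Real.cos (ζ / 2) * Real.sin (ζ / 2)) := by
  set z : ℂ := ⟨p - q, 2 * r⟩ with hz
  have hre : ‖z‖ * Real.cos z.arg = p - q := Complex.norm_mul_cos_arg z
  have him : ‖z‖ * Real.sin z.arg = 2 * r := Complex.norm_mul_sin_arg z
  have hn0 := norm_nonneg z
  have hn : ‖z‖ < 1 := by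
    have : ‖z‖ ^ 2 = (p - q) ^ 2 + (2 * r) ^ 2 := by
      rw [← hre, ← him]
      linear_combination (-‖z‖ ^ 2) * Real.sin_sq_add_cos_sq z.arg
    nlinarith
  have hcos : Real.cos z.arg = 2 * Real.cos (z.arg / 2) ^ 2 - 1 := by
    rw [← Real.cos_two_mul]; ring_nf
  have hsin : Real.sin z.arg = 2 * Real.sin (z.arg / 2) * Real.cos (z.arg / 2) := by
    rw [← Real.sin_two_mul]; ring_nf
  have hcs := Real.sin_sq_add_cos_sq (z.arg / 2)
  rw [hcos] at hre
  rw [hsin] at him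
  refine ⟨z.arg, (1 + ‖z‖) / 2, (1 - ‖z‖) / 2, by linarith, by linarith, by ring, ?_, ?_, ?_⟩
  · linear_combination (1 / 2) * h1 - (1 / 2) * hre - (1 / 2 - ‖z‖ / 2) * hcs
  · linear_combination (1 / 2) * h1 + (1 / 2) * hre - (1 / 2 + ‖z‖ / 2) * hcs
  · linear_combination (-1 / 2) * him

lemma isGHZLikeMixture_of_gram {ρ : Operator ι} {a b : ι} {A B : QubitMeasurement}
    {χ : Fin 2 → Ket {j : ι // j ≠ a ∧ j ≠ b}} (hχ : ∀ c, ‖χ c‖ = 1) {p q : ℝ} {x : ℂ}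
    (h1 : p + q = 1) (hdet : Complex.normSq x < p * q)
    (h : ∀ s t, ρ s t =
      p * (pairKet a b (A 0) (B 0) (χ 0) s * conj (pairKet a b (A 0) (B 0) (χ 0) t)) +
      x * (pairKet a b (A 0) (B 0) (χ 0) s * conj (pairKet a b (A 1) (B 1) (χ 1) t)) +
      conj x * (pairKet a b (A 1) (B 1) (χ 1) s * conj (pairKet a b (A 0) (B 0) (χ 0) t)) +
      q * (pairKet a b (A 1) (B 1) (χ 1) s * conj (pairKet a b (A 1) (B 1) (χ 1) t))) :
    IsGHZLikeMixture ρ a b := by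
  obtain ⟨z, hz, hxz⟩ : ∃ z : ℂ, ‖z‖ = 1 ∧ x = ‖x‖ * z := by
    by_cases hx : x = 0
    · exact ⟨1, by simp, by simp [hx]⟩
    · have : (‖x‖ : ℂ) ≠ 0 := by exact_mod_cast norm_ne_zero_iff.mpr hx
      exact ⟨x / ‖x‖, by rw [norm_div, Complex.norm_real, norm_norm,
        div_self (norm_ne_zero_iff.mpr hx)], by field_simp⟩
  have hzz : z * conj z = 1 := by rw [Complex.mul_conj, Complex.normSq_eq_norm_sq, hz]; simp
  rw [Complex.normSq_eq_norm_sq] at hdet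
  obtain ⟨ζ, ν₁, ν₂, hν₁, hν₂, hν, hp, hq, hr⟩ := exists_rotation_diagonalizing h1 hdet
  refine ⟨A, B, χ 0, conj z • χ 1, ζ, ν₁, ν₂, hχ 0, ?_, hν₁, hν₂, hν, ?_⟩
  · rw [norm_smul, RCLike.norm_conj, hz, hχ, one_mul]
  · ext s t
    rw [h, hxz, hr, hp, hq, pairKet_smul]
    simp only [ketbra, Matrix.add_apply, Matrix.smul_apply, Matrix.of_apply, PiLp.add_apply,
      PiLp.sub_apply, PiLp.smul_apply, smul_eq_mul, map_add, map_sub, map_mul, Complex.conj_ofReal,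
      Complex.conj_conj]
    push_cast
    generalize pairKet a b (A 0) (B 0) (χ 0) s = s0
    generalize conj (pairKet a b (A 0) (B 0) (χ 0) t) = t0
    generalize pairKet a b (A 1) (B 1) (χ 1) s = s1
    generalize conj (pairKet a b (A 1) (B 1) (χ 1) t) = t1
    linear_combination (-(ν₁ * Complex.sin (ζ / 2) ^ 2 + ν₂ * Complex.cos (ζ / 2) ^ 2) * (s1 * t1))
      * hzz

/-! ### Violation of local realism by the mixed states -/

/-- Two nonzero multilinear forms have a common point where they do not vanish. -/
lemma exists_common_ne_zero (F G : MultilinearMap ℂ (fun _ : ι => Qubit) ℂ) {v w : ι → Qubit}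
    (hF : F v ≠ 0) (hG : G w ≠ 0) : ∃ u, F u ≠ 0 ∧ G u ≠ 0 := by
  suffices h : ∀ S : Finset ι, ∃ u, F u ≠ 0 ∧ G ((Finset.univ \ S).piecewise w u) ≠ 0 by
    obtain ⟨u, hF, hG⟩ := h Finset.univ
    rw [Finset.sdiff_self, Finset.piecewise_empty] at hG
    exact ⟨u, hF, hG⟩
  intro S
  induction S using Finset.induction_on with
  | empty => exact ⟨v, hF, by rwa [Finset.sdiff_empty, Finset.piecewise_univ]⟩
  | insert i S hi ih =>
    obtain ⟨u, hFu, hGu⟩ := ih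
    set T := Finset.univ \ insert i S with hT
    have hiT : i ∉ T := by simp [hT]
    have hTi : Finset.univ \ S = insert i T := by
      ext j
      by_cases hj : j = i <;> simp [hT, hj, hi]
    rw [hTi, Finset.piecewise_insert] at hGu
    have hFz : ∀ z : ℂ, F (Function.update u i (u i + z • w i)) =
        F u + z * F (Function.update u i (w i)) := by
      intro z
      rw [MultilinearMap.map_update_add, MultilinearMap.map_update_smul, Function.update_eq_self,
        smul_eq_mul]
    have hGz : ∀ z : ℂ, G (T.piecewise w (Function.update u i (u i + z • w i))) =
        G (T.piecewise w u) + z * G (Function.update (T.piecewise w u) i (w i)) := by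
      intro z
      rw [← Finset.update_piecewise_of_notMem _ _ _ hiT, MultilinearMap.map_update_add,
        MultilinearMap.map_update_smul, smul_eq_mul]
      congr 2
      rw [Function.update_eq_self_iff, Finset.piecewise_eq_of_notMem _ _ _ hiT]
    by_contra! hcon
    have key : ∀ z : ℂ, F u + z * F (Function.update u i (w i)) ≠ 0 →
        G (T.piecewise w u) + z * G (Function.update (T.piecewise w u) i (w i)) = 0 := by
      intro z hz
      rw [← hGz]
      exact hcon _ (by rwa [hFz])
    have h0 : G (T.piecewise w u) = 0 := by simpa using key 0 (by simpa using hFu)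
    have h1 : ∀ z : ℂ, z ≠ 0 → F u + z * F (Function.update u i (w i)) = 0 := by
      intro z hz
      by_contra hne
      have := key z hne
      rw [h0, zero_add] at this
      exact (mul_ne_zero hz hGu) this
    exact hFu (by linear_combination 2 * h1 1 one_ne_zero - h1 2 two_ne_zero)

lemma exists_overlap_ne_zero {ψ : Ket ι} (hψ : ψ ≠ 0) : ∃ v, overlap ψ v ≠ 0 := by
  obtain ⟨s, hs⟩ : ∃ s, ψ s ≠ 0 := by
    by_contra! h0
    exact hψ (by ext s; simpa using h0 s)
  exact ⟨_, by rw [overlap_single]; simpa using hs⟩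

lemma overlap_sum {K : Type*} (S : Finset K) (z : K → ℂ) (η : K → Ket ι) (v : ι → Qubit) :
    overlap (∑ c ∈ S, z c • η c) v = ∑ c ∈ S, conj (z c) * overlap (η c) v := by
  simp only [overlap_apply, WithLp.ofLp_sum, Finset.sum_apply, PiLp.smul_apply, smul_eq_mul,
    map_sum, map_mul, Finset.sum_mul, Finset.mul_sum]
  rw [Finset.sum_comm]
  simp only [mul_assoc]

/-- A coherent superposition of the two product vectors violates local realism. -/
lemma violates_of_coherence {K : Type*} [Fintype K] {ρ : Operator ι} {Ψ : K → Ket ι}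
    (hρ : Decomposes ρ Ψ) {a b : ι} (hab : a ≠ b) {A B : QubitMeasurement}
    {χ : Fin 2 → Ket {j : ι // j ≠ a ∧ j ≠ b}} (hχ : ∀ c, χ c ≠ 0) {α : K → Fin 2 → ℂ}
    (h : ∀ j, Ψ j = ∑ c, α j c • pairKet a b (A c) (B c) (χ c))
    (hx : ∑ j, α j 0 * conj (α j 1) ≠ 0) : ViolatesLocalRealism ρ := by
  obtain ⟨v, hv⟩ := exists_overlap_ne_zero (hχ 0)
  obtain ⟨v', hv'⟩ := exists_overlap_ne_zero (hχ 1)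
  obtain ⟨w, hw0, hw1⟩ := exists_common_ne_zero _ _ hv hv'
  let W : ι → Qubit := fun j => if h : j ≠ a ∧ j ≠ b then w ⟨j, h⟩ else 0
  have hA := orthonormal_iff_ite.mp A.orthonormal
  have hB := orthonormal_iff_ite.mp B.orthonormal
  have hF : ∀ j c d, overlap (Ψ j) (Function.update (Function.update W a (A c)) b (B d)) =
      ∑ e, conj (α j e) *
        ((if e = c then 1 else 0) * (if e = d then 1 else 0) * overlap (χ e) w) := by
    intro j c d
    have hW : (fun k : {j // j ≠ a ∧ j ≠ b} =>
        Function.update (Function.update W a (A c)) b (B d) k) = w := by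
      funext k
      simp [W, k.2.1, k.2.2]
    rw [h, overlap_sum]
    refine Finset.sum_congr rfl fun e _ => ?_
    rw [overlap_pairKet hab, hW, update_pair_apply hab, update_pair_apply hab, if_pos rfl,
      if_neg hab.symm, if_pos rfl, hA, hB]
  refine violates_of_correlated hρ hab W A B (fun j => by simp [hF]) (fun j => by simp [hF]) ?_
  have : ∑ j, conj (overlap (Ψ j) (Function.update (Function.update W a (A 0)) b (B 0))) *
      overlap (Ψ j) (Function.update (Function.update W a (A 1)) b (B 1)) =
      (∑ j, α j 0 * conj (α j 1)) * (conj (overlap (χ 0) w) * overlap (χ 1) w) := by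
    rw [Finset.sum_mul]
    refine Finset.sum_congr rfl fun j _ => ?_
    simp [hF]
    ring
  rw [this]
  exact mul_ne_zero hx (mul_ne_zero (by simpa using hw0) hw1)

/-- A mixture of the two product vectors, one of which is entangled, violates local realism. -/
lemma violates_of_entangled_component {K : Type*} [Fintype K] {ρ : Operator ι} {Ψ : K → Ket ι}
    (hρ : Decomposes ρ Ψ) {a b : ι} (hab : a ≠ b) {A B : QubitMeasurement}
    {χ : Fin 2 → Ket {j : ι // j ≠ a ∧ j ≠ b}} (hχ : ∀ c, ‖χ c‖ = 1) {α : K → Fin 2 → ℂ}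
    (h : ∀ j, Ψ j = ∑ c, α j c • pairKet a b (A c) (B c) (χ c)) (c : Fin 2)
    (hpos : 0 < ∑ j, Complex.normSq (α j c))
    (hent : ¬ IsSeparable (ketbra (pairKet a b (A c) (B c) (χ c)))) :
    ViolatesLocalRealism ρ := by
  have hA := orthonormal_iff_ite.mp A.orthonormal
  have hn : ‖pairKet a b (A c) (B c) (χ c)‖ = 1 := by
    rw [norm_pairKet hab (A.orthonormal.1 c) (B.orthonormal.1 c), hχ]
  obtain ⟨a', b', hab', w, u, u', v, v', hne⟩ := exists_entangled_pair hn hent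
  have hfac : ∀ (z : ι → Qubit) (y : Qubit),
      overlap (pairKet a b (A c) (B c) (χ c)) (Function.update z a y) =
      inner ℂ (A c) y *
        overlap (pairKet a b (A c) (B c) (χ c)) (Function.update z a (A c)) := by
    intro z y
    have hz : ∀ y, (fun k : {j // j ≠ a ∧ j ≠ b} => Function.update z a y k) =
        fun k : {j // j ≠ a ∧ j ≠ b} => z k := by
      intro y
      funext k
      rw [Function.update_of_ne k.2.1]
    simp only [overlap_pairKet hab, hz, Function.update_self, Function.update_of_ne hab.symm, hA,
      if_true]
    ring
  have ha' : a' ≠ a := by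
    rintro rfl
    apply hne
    simp only [Function.update_comm hab']
    rw [hfac _ u, hfac _ u', hfac (Function.update w b' v') u, hfac (Function.update w b' v) u']
    ring
  have hb' : b' ≠ a := by
    rintro rfl
    apply hne
    rw [hfac _ v, hfac _ v', hfac (Function.update w a' u') v, hfac (Function.update w a' u) v']
    ring
  have hslice : ∀ (ψ : Ket ι) (s t : Qubit),
      overlap ψ (Function.update (Function.update (Function.update w a (A c)) a' s) b' t) =
      overlap ψ (Function.update (Function.update (Function.update w a' s) b' t) a (A c)) := by
    intro ψ s t
    rw [Function.update_comm ha'.symm, Function.update_comm hb'.symm]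
  have hwa : ∀ s t, overlap (pairKet a b (A c) (B c) (χ c))
      (Function.update (Function.update w a' s) b' t) = inner ℂ (A c) (w a) *
      overlap (pairKet a b (A c) (B c) (χ c))
        (Function.update (Function.update (Function.update w a (A c)) a' s) b' t) := by
    intro s t
    have hself : Function.update (Function.update (Function.update w a' s) b' t) a (w a) =
        Function.update (Function.update w a' s) b' t := by
      rw [Function.update_eq_self_iff, Function.update_of_ne hb'.symm,
        Function.update_of_ne ha'.symm]
    rw [hslice, ← hfac, hself]
  obtain ⟨A', B', h01, h10, h00, h11⟩ := exists_schmidt_pair (pairKet a b (A c) (B c) (χ c)) hab'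
    (Function.update w a (A c)) ⟨u, u', v, v', fun heq => hne (by
      simp only [hwa]
      linear_combination (inner ℂ (A c) (w a)) ^ 2 * heq)⟩
  have hF : ∀ j s t, overlap (Ψ j)
      (Function.update (Function.update (Function.update w a (A c)) a' s) b' t) =
      conj (α j c) * overlap (pairKet a b (A c) (B c) (χ c))
        (Function.update (Function.update (Function.update w a (A c)) a' s) b' t) := by
    intro j s t
    rw [h, overlap_sum]
    refine Finset.sum_eq_single c (fun d _ hd => ?_) (by simp)
    rw [hslice, overlap_pairKet hab, Function.update_self, hA, if_neg hd]
    ring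
  refine violates_of_correlated hρ hab' (Function.update w a (A c)) A' B'
    (fun j => by rw [hF, h01, mul_zero]) (fun j => by rw [hF, h10, mul_zero]) ?_
  simp only [hF]
  have hsum : ∀ y z : ℂ, ∑ j, conj (conj (α j c) * y) * (conj (α j c) * z) =
      ((∑ j, Complex.normSq (α j c) : ℝ) : ℂ) * (conj y * z) := by
    intro y z
    push_cast
    rw [Finset.sum_mul]
    refine Finset.sum_congr rfl fun j _ => ?_
    rw [← Complex.mul_conj, map_mul, Complex.conj_conj]
    ring
  rw [hsum]
  exact mul_ne_zero (by exact_mod_cast hpos.ne') (mul_ne_zero (by simpa using h00) h11)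

/-- The dichotomy for states of which two observers can steer the rest. -/
theorem violates_and_form {ρ : Operator ι} (hρ : IsState ρ) (hent : IsEntangled ρ) {a b : ι}
    (hab : a ≠ b) (ha : CanSteer ρ a) (hb : CanSteer ρ b) :
    ViolatesLocalRealism ρ ∧ (IsPure ρ ∨ IsGHZLikeMixture ρ a b) := by
  obtain ⟨m, Ψ, hΨ⟩ := exists_decomposition hρ.1
  obtain ⟨A, φ, α, hφ0, hφ, hα⟩ := ha.exists_structure hΨ
  set η : Fin 2 → Ket ι := fun c => WithLp.toLp 2 fun s => A c (s a) * φ c s with hη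
  have hΨη : ∀ j, Ψ j = ∑ c, α j c • η c := by
    intro j
    ext s
    rw [contract_resolution A a (Ψ j) s]
    simp [hα, hη]
    ring
  have hA := orthonormal_iff_ite.mp A.orthonormal
  have hcη : ∀ c d, contract a (A d) (η c) = (if d = c then (1 : ℂ) else 0) • φ c := by
    intro c d
    rw [contract_mul a (A d) (A c) (hφ c) fun s => rfl, hA]
  rcases (normSq_sum_mul_conj_le (fun j => α j 0) fun j => α j 1).eq_or_lt with hdet | hdet
  · have hpure : IsPure ρ := isPure_of_gram_eq hρ.2
      (Finset.sum_nonneg fun j _ => Complex.normSq_nonneg _)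
      (Finset.sum_nonneg fun j _ => Complex.normSq_nonneg _) hdet (hΨ.apply_span_two hΨη)
    refine ⟨?_, Or.inl hpure⟩
    obtain ⟨ψ, hψ, rfl⟩ := hpure
    exact violates_of_pure_entangled hψ hent
  · have hη0 : ∀ c, η c ≠ 0 := by
      intro c h0
      have := hcη c c
      rw [h0, contract_zero, if_pos rfl, one_smul] at this
      exact hφ0 c this.symm
    obtain ⟨B, χ, hχ⟩ := exists_pairKet_structure hΨ hab hη0
      (fun c d hd => by rw [hcη, if_neg hd, zero_smul]) (mem_span_of_gram hΨη hdet) hb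
    have hχ0 : ∀ c, ‖χ c‖ ≠ 0 := by
      intro c h0
      apply hη0 c
      rw [← norm_eq_zero, hχ, norm_pairKet hab (A.orthonormal.1 c) (B.orthonormal.1 c), h0]
    set χ' : Fin 2 → Ket {j : ι // j ≠ a ∧ j ≠ b} := fun c => ((‖χ c‖⁻¹ : ℝ) : ℂ) • χ c with hχ'
    have hχ1 : ∀ c, ‖χ' c‖ = 1 := fun c => by
      rw [norm_smul, Complex.norm_real, norm_inv, norm_norm, inv_mul_cancel₀ (hχ0 c)]
    set α' : Fin m → Fin 2 → ℂ := fun j c => α j c * (‖χ c‖ : ℝ) with hα'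
    have hΨ' : ∀ j, Ψ j = ∑ c, α' j c • pairKet a b (A c) (B c) (χ' c) := by
      intro j
      rw [hΨη]
      refine Finset.sum_congr rfl fun c _ => ?_
      have : (‖χ c‖ : ℂ) ≠ 0 := by exact_mod_cast hχ0 c
      rw [hχ, hχ', pairKet_smul, smul_smul, hα', Complex.ofReal_inv, mul_assoc,
        mul_inv_cancel₀ this, mul_one]
    have hdiag : ∀ c, ∑ j, Complex.normSq (α' j c) =
        ‖χ c‖ ^ 2 * ∑ j, Complex.normSq (α j c) := by
      intro c
      rw [Finset.mul_sum]
      refine Finset.sum_congr rfl fun j _ => ?_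
      rw [hα', Complex.normSq_mul, Complex.normSq_ofReal]
      ring
    have hoff : ∑ j, α' j 0 * conj (α' j 1) =
        ((‖χ 0‖ * ‖χ 1‖ : ℝ) : ℂ) * ∑ j, α j 0 * conj (α j 1) := by
      rw [Finset.mul_sum]
      refine Finset.sum_congr rfl fun j _ => ?_
      simp only [hα', map_mul, Complex.conj_ofReal, Complex.ofReal_mul]
      ring
    have hdet' : Complex.normSq (∑ j, α' j 0 * conj (α' j 1)) <
        (∑ j, Complex.normSq (α' j 0)) * ∑ j, Complex.normSq (α' j 1) := by
      rw [hdiag, hdiag, hoff, Complex.normSq_mul, Complex.normSq_ofReal]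
      have h0 : 0 < ‖χ 0‖ ^ 2 * ‖χ 1‖ ^ 2 :=
        mul_pos (pow_pos ((norm_nonneg _).lt_of_ne' (hχ0 0)) 2)
          (pow_pos ((norm_nonneg _).lt_of_ne' (hχ0 1)) 2)
      linarith [mul_lt_mul_of_pos_left hdet h0]
    have happ := hΨ.apply_span_two hΨ'
    have hnn : ∀ c, 0 ≤ ∑ j, Complex.normSq (α' j c) :=
      fun c => Finset.sum_nonneg fun j _ => Complex.normSq_nonneg _
    have hpos : ∀ c, 0 < ∑ j, Complex.normSq (α' j c) := by
      have h0 := (Complex.normSq_nonneg _).trans_lt hdet'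
      intro c
      refine (hnn c).lt_of_ne' fun hc => ?_
      fin_cases c
      · simp only [Fin.zero_eta] at hc
        rw [hc, zero_mul] at h0; exact lt_irrefl _ h0
      · simp only [Fin.mk_one] at hc
        rw [hc, mul_zero] at h0; exact lt_irrefl _ h0
    have hin : ∀ c d, inner ℂ (pairKet a b (A c) (B c) (χ' c)) (pairKet a b (A d) (B d) (χ' d)) =
        if c = d then (1 : ℂ) else 0 := by
      intro c d
      rw [inner_pairKet hab, hA]
      split_ifs with hcd
      · subst hcd
        simp [inner_self_eq_norm_sq_to_K, hχ1, B.orthonormal.1]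
      · simp
    have htrace : ∑ j, Complex.normSq (α' j 0) + ∑ j, Complex.normSq (α' j 1) = 1 := by
      have htr := hρ.2
      simp only [Matrix.trace, Matrix.diag_apply, happ, Finset.sum_add_distrib,
        ← Finset.mul_sum] at htr
      simp only [PiLp.inner_apply, RCLike.inner_apply] at hin
      simp only [hin] at htr
      simp at htr
      exact_mod_cast htr
    refine ⟨?_, Or.inr (isGHZLikeMixture_of_gram hχ1 htrace hdet' happ)⟩
    by_cases hx : ∑ j, α' j 0 * conj (α' j 1) = 0
    · have hsome : ∃ c, ¬ IsSeparable (ketbra (pairKet a b (A c) (B c) (χ' c))) := by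
        by_contra! hsep
        refine hent ?_
        have heq : ρ =
            (∑ j, Complex.normSq (α' j 0)) • ketbra (pairKet a b (A 0) (B 0) (χ' 0)) +
            (∑ j, Complex.normSq (α' j 1)) • ketbra (pairKet a b (A 1) (B 1) (χ' 1)) := by
          ext s t
          rw [happ, hx]
          simp [ketbra]
        rw [IsSeparable, heq]
        exact (convex_convexHull ℝ _) (hsep 0) (hsep 1) (hnn 0) (hnn 1) htrace
      obtain ⟨c, hc⟩ := hsome
      exact violates_of_entangled_component hΨ hab hχ1 hΨ' c (hpos c) hc
    · exact violates_of_coherence hΨ hab (fun c h0 => by simpa [h0] using hχ1 c) hΨ' hx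

end

end NQubit
end

theorem theorem2 (N : ℕ) (ρ : NQubit.Operator (Fin N)) (hρ : NQubit.IsState ρ)
    (hent : NQubit.IsEntangled ρ) (a b : Fin N) (hab : a ≠ b)
    (ha : NQubit.CanSteer ρ a) (hb : NQubit.CanSteer ρ b) :
    NQubit.ViolatesLocalRealism ρ ∧
      (NQubit.IsPure ρ ∨ NQubit.IsGHZLikeMixture ρ a b) :=
  NQubit.violates_and_form hρ hent hab ha hb
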